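/- Let $\Omega\subset\mathbb R^n$, $n\in\{1,2,3\}$, be a bounded convex domain, $T>0$, $Q=\Omega\times(0,T)$, $Q_-=\Omega\times(-T,T)$, and $\Box=\partial_{tt}-\Delta_x$. Let $$H^{1,1}_{0;0,}(Q)=\{u\in L^2(0,T;H^1_0(\Omega))\cap H^1(0,T;L^2(\Omega)):u(\cdot,0)=0\},$$ and let $Y=H^{1,1}_{0;,0}(Q)$ be defined in the same way with $u(\cdot,T)=0$ in place of $u(\cdot,0)=0$. For $u\in L^2(Q)$ let $\widetilde u$ be its extension by zero to $Q_-$, and let $\Box\widetilde u$ be the distribution $\langle\Box\widetilde u,\varphi\rangle=\int_Q u\,\Box\varphi\,dx\,dt$, $\varphi\in C_0^\infty(Q_-)$. Let $\mathcal H(Q)=\{u\in L^2(Q):\Box\widetilde u\in[H^1_0(Q_-)]^*\}$ with the norm $\big(\|u\|_{L^2(Q)}^2+\|\Box\widetilde u\|_{[H^1_0(Q_-)]^*}^2\big)^{1/2}$, and let $X$ be the closure of $H^{1,1}_{0;0,}(Q)$ in $\mathcal H(Q)$. Let $\mathcal E:Y\to H^1_0(Q_-)$ be the reflection in time, $(\mathcal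 Eq)(x,t)=q(x,|t|)$, and define $$B:X\to Y^*,\quad \langle Bu,q\rangle=\langle\Box\widetilde u,\mathcal Eq\rangle,\qquad A:Y\to Y^*,\quad \langle Aw,q\rangle=\langle\partial_tw,\partial_tq\rangle_{L^2(Q)}+\langle\nabla_xw,\nabla_xq\rangle_{L^2(Q)},$$ $$S=B^*A^{-1}B:X\to X^*,\qquad \|u\|_S=\langle Su,u\rangle^{1/2}\quad(u\in X).$$ Theorem. Let $\overline u\in L^2(Q)$ and $\varrho>0$. There is a unique $u_\varrho\in X$ such that $$\varrho\,\langle Su_\varrho,v\rangle+\langle u_\varrho,v\rangle_{L^2(Q)}=\langle\overline u,v\rangle_{L^2(Q)}\quad\text{for all }v\in X,$$ and it satisfies $$\|u_\varrho-\overline u\|_{L^2(Q)}\le\|\overline u\|_{L^2(Q)}.$$ If $\overline u\in X$, then $$\|u_\varrho-\overline u\|_{L^2(Q)}\le\sqrt\varrho\,\|\overline u\|_S\quad\text{and}\quad\|u_\varrho-\overline u\|_S\le\|\overline u\|_S.$$ If, in addition, $S\overline u\in L^2(Q)$, that is, if there is $f\in L^2(Q)$, denoted by $S\overline u$, with $\langle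 S\overline u,v\rangle=\langle f,v\rangle_{L^2(Q)}$ for all $v\in X$, then $$\|u_\varrho-\overline u\|_{L^2(Q)}\le\varrho\,\|S\overline u\|_{L^2(Q)}\quad\text{and}\quad\|u_\varrho-\overline u\|_S\le\sqrt\varrho\,\|S\overline u\|_{L^2(Q)}.$$ -/

import Mathlib

noncomputable section
namespace WaveReg
open MeasureTheory Set Filter Topology
open scoped ENNReal ContDiff Gradient InnerProductSpace

/-- The Euclidean space `ℝⁿ`. Space-time points are pairs `(x, t)` in `Pt n × ℝ`. -/
abbrev Pt (n : ℕ) := EuclideanSpace ℝ (Fin n)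

/-- `φ ∈ C_c^∞(D)`. -/
def IsTest {F : Type*} [NormedAddCommGroup F] [NormedSpace ℝ F] (D : Set F) (φ : F → ℝ) : Prop :=
  ContDiff ℝ ∞ φ ∧ HasCompactSupport φ ∧ tsupport φ ⊆ D

/-- The time derivative `∂ₜφ` of a smooth function. -/
def dt {n : ℕ} (φ : Pt n × ℝ → ℝ) (p : Pt n × ℝ) : ℝ := deriv (fun s => φ (p.1, s)) p.2
/-- The spatial gradient `∇ₓφ` of a smooth function. -/
def gradx {n : ℕ} (φ : Pt n × ℝ → ℝ) (p : Pt n × ℝ) : Pt n := ∇ (fun y => φ (y, p.2)) p.1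
/-- The wave operator `□φ = ∂ₜₜφ - Δₓφ` of a smooth function. -/
def box {n : ℕ} (φ : Pt n × ℝ → ℝ) (p : Pt n × ℝ) : ℝ :=
  iteratedFDeriv ℝ 2 φ p ![(0, 1), (0, 1)] -
    ∑ i : Fin n, iteratedFDeriv ℝ 2 φ p
      ![(EuclideanSpace.single i 1, 0), (EuclideanSpace.single i 1, 0)]

section tests
variable {F : Type*} [NormedAddCommGroup F] [NormedSpace ℝ F] {D : Set F} {φ ψ : F → ℝ}
theorem IsTest.zero : IsTest D (fun _ => (0:ℝ)) := by
  refine ⟨contDiff_const, HasCompactSupport.zero, ?_⟩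
  have : tsupport (fun _ : F => (0:ℝ)) = ∅ := by
    rw [tsupport_eq_empty_iff]; rfl
  rw [this]; exact empty_subset _
theorem IsTest.add (h : IsTest D φ) (k : IsTest D ψ) : IsTest D (fun x => φ x + ψ x) :=
  ⟨h.1.add k.1, h.2.1.add k.2.1, (tsupport_add φ ψ).trans (union_subset h.2.2 k.2.2)⟩
theorem IsTest.smul (c : ℝ) (h : IsTest D φ) : IsTest D (fun x => c * φ x) :=
  ⟨contDiff_const.mul h.1, h.2.1.mul_left, (tsupport_mul_subset_right).trans h.2.2⟩
end tests

variable {n : ℕ}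

theorem grad_add' {f g : Pt n → ℝ} (hf : Differentiable ℝ f) (hg : Differentiable ℝ g) (x : Pt n) :
    ∇ (fun y => f y + g y) x = ∇ f x + ∇ g x := by
  simp [gradient, fderiv_fun_add (hf x) (hg x)]
theorem grad_smul' {f : Pt n → ℝ} (c : ℝ) (hf : Differentiable ℝ f) (x : Pt n) :
    ∇ (fun y => c * f y) x = c • ∇ f x := by
  simp [gradient, fderiv_const_mul (hf x)]

/-- Pairs `(v, ∇v)` in `L²(Ω) × L²(Ω; ℝⁿ)`, with the full `H¹(Ω)` norm. -/
abbrev Graph (Ω : Set (Pt n)) : Type :=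
  WithLp 2 (Lp ℝ 2 (volume.restrict Ω) × Lp (Pt n) 2 (volume.restrict Ω))

/-- The pairs `(φ, ∇φ)` with `φ ∈ C_c^∞(Ω)`. -/
def testGraph (Ω : Set (Pt n)) : Submodule ℝ (Graph Ω) where
  carrier := {w | ∃ φ : Pt n → ℝ, IsTest Ω φ ∧
    w.fst =ᵐ[volume.restrict Ω] φ ∧ w.snd =ᵐ[volume.restrict Ω] ∇ φ}
  zero_mem' := by
    refine ⟨_, IsTest.zero, Lp.coeFn_zero _ _ _, ?_⟩
    filter_upwards [Lp.coeFn_zero (Pt n) 2 (volume.restrict Ω)] with x hx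
    simp only [WithLp.zero_snd, hx]
    simp [gradient]
  add_mem' := by
    rintro v w ⟨φ, hφ, h1, h2⟩ ⟨ψ, hψ, k1, k2⟩
    refine ⟨_, hφ.add hψ, ?_, ?_⟩
    · filter_upwards [h1, k1, Lp.coeFn_add v.fst w.fst] with x a b c
      simp only [WithLp.add_fst, c, Pi.add_apply, a, b]
    · filter_upwards [h2, k2, Lp.coeFn_add v.snd w.snd] with x a b c
      simp only [WithLp.add_snd, c, Pi.add_apply, a, b]
      rw [grad_add' (hφ.1.differentiable (by simp)) (hψ.1.differentiable (by simp))]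
  smul_mem' := by
    rintro r w ⟨φ, hφ, h1, h2⟩
    refine ⟨_, hφ.smul r, ?_, ?_⟩
    · filter_upwards [h1, Lp.coeFn_smul r w.fst] with x a c
      simp only [WithLp.smul_fst, c, Pi.smul_apply, a, smul_eq_mul]
    · filter_upwards [h2, Lp.coeFn_smul r w.snd] with x a c
      simp only [WithLp.smul_snd, c, Pi.smul_apply, a]
      rw [grad_smul' _ (hφ.1.differentiable (by simp))]

/-- `H¹₀(Ω)`, the closure of `C_c^∞(Ω)` in `H¹(Ω)`; an element is the pair `(v, ∇v)`. -/
def H10 (Ω : Set (Pt n)) : Submodule ℝ (Graph Ω) := (testGraph Ω).topologicalClosure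

/-- `L²(D)` for a space-time set `D`. -/
abbrev L2 (D : Set (Pt n × ℝ)) : Type := Lp ℝ 2 (volume.restrict D)
/-- `L²(D; ℝⁿ)` for a space-time set `D`. -/
abbrev L2vec (D : Set (Pt n × ℝ)) : Type := Lp (Pt n) 2 (volume.restrict D)
/-- Triples `(w, ∂ₜw, ∇ₓw)` in `L²(D) × (L²(D) × L²(D; ℝⁿ))`, with the full `H¹(D)` norm. -/
abbrev Jet (D : Set (Pt n × ℝ)) : Type := WithLp 2 (L2 D × WithLp 2 (L2 D × L2vec D))

/-- `w` is the triple `(φ, ∂ₜφ, ∇ₓφ)`. -/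
def IsJetOf {D : Set (Pt n × ℝ)} (w : Jet D) (φ : Pt n × ℝ → ℝ) : Prop :=
  w.fst =ᵐ[volume.restrict D] φ ∧ w.snd.fst =ᵐ[volume.restrict D] dt φ ∧
    w.snd.snd =ᵐ[volume.restrict D] gradx φ

/-- The triples `(φ, ∂ₜφ, ∇ₓφ)` with `φ ∈ C_c^∞(D)`. -/
def testJet (D : Set (Pt n × ℝ)) : Submodule ℝ (Jet D) where
  carrier := {w | ∃ φ : Pt n × ℝ → ℝ, IsTest D φ ∧ IsJetOf w φ}
  zero_mem' := by
    refine ⟨_, IsTest.zero, Lp.coeFn_zero _ _ _, ?_, ?_⟩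
    · filter_upwards [Lp.coeFn_zero ℝ 2 (volume.restrict D)] with x hx
      simp only [WithLp.zero_snd, WithLp.zero_fst, hx]
      simp [dt]
    · filter_upwards [Lp.coeFn_zero (Pt n) 2 (volume.restrict D)] with x hx
      simp only [WithLp.zero_snd, hx]
      simp [gradx, gradient]
  add_mem' := by
    rintro v w ⟨φ, hφ, h1, h2, h3⟩ ⟨ψ, hψ, k1, k2, k3⟩
    have dφ := hφ.1.differentiable (by simp)
    have dψ := hψ.1.differentiable (by simp)
    refine ⟨_, hφ.add hψ, ?_, ?_, ?_⟩
    · filter_upwards [h1, k1, Lp.coeFn_add v.fst w.fst] with x a b c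
      simp only [WithLp.add_fst, c, Pi.add_apply, a, b]
    · filter_upwards [h2, k2, Lp.coeFn_add v.snd.fst w.snd.fst] with x a b c
      simp only [WithLp.add_snd, WithLp.add_fst, c, Pi.add_apply, a, b, dt]
      rw [deriv_fun_add (by fun_prop) (by fun_prop)]
    · filter_upwards [h3, k3, Lp.coeFn_add v.snd.snd w.snd.snd] with x a b c
      simp only [WithLp.add_snd, c, Pi.add_apply, a, b, gradx]
      rw [grad_add' (by fun_prop) (by fun_prop)]
  smul_mem' := by
    rintro r w ⟨φ, hφ, h1, h2, h3⟩
    have dφ := hφ.1.differentiable (by simp)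
    refine ⟨_, hφ.smul r, ?_, ?_, ?_⟩
    · filter_upwards [h1, Lp.coeFn_smul r w.fst] with x a c
      simp only [WithLp.smul_fst, c, Pi.smul_apply, a, smul_eq_mul]
    · filter_upwards [h2, Lp.coeFn_smul r w.snd.fst] with x a c
      simp only [WithLp.smul_snd, WithLp.smul_fst, c, Pi.smul_apply, a, smul_eq_mul, dt]
      rw [deriv_const_mul _ (by fun_prop)]
    · filter_upwards [h3, Lp.coeFn_smul r w.snd.snd] with x a c
      simp only [WithLp.smul_snd, c, Pi.smul_apply, a, gradx]
      rw [grad_smul' _ (by fun_prop)]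

/-- `H¹₀(D)` for a space-time set `D`: the closure of `C_c^∞(D)` in `H¹(D)`; an element is the
triple `(w, ∂ₜw, ∇ₓw)`. -/
def H10st (D : Set (Pt n × ℝ)) : Submodule ℝ (Jet D) := (testJet D).topologicalClosure

instance (D : Set (Pt n × ℝ)) : CompleteSpace (H10st D) :=
  inferInstanceAs (CompleteSpace (testJet D).topologicalClosure)


section aux
set_option linter.unusedSectionVars false

theorem lint_sq {α F : Type*} [MeasurableSpace α] [NormedAddCommGroup F] {μ : Measure α}
    (f : α → F) : ∫⁻ x, ‖f x‖ₑ ^ 2 ∂μ = eLpNorm f 2 μ ^ 2 := by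
  have h := eLpNorm_nnreal_pow_eq_lintegral (f := f) (μ := μ) (p := 2) (by norm_num)
  simpa using h.symm

theorem Lp_lint_sq {α F : Type*} [MeasurableSpace α] [NormedAddCommGroup F] {μ : Measure α}
    (f : Lp F 2 μ) : ∫⁻ x, ‖f x‖ₑ ^ 2 ∂μ = ‖f‖ₑ ^ 2 := by
  rw [lint_sq, Lp.enorm_def]

theorem ae_iInf {α : Type*} [MeasurableSpace α] {μ : Measure α} {f : ℕ → α → ℝ≥0∞}
    (hf : ∀ k, Measurable (f k)) (h : Tendsto (fun k => ∫⁻ x, f k x ∂μ) atTop (𝓝 0)) :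
    ∀ᵐ x ∂μ, ⨅ k, f k x = 0 := by
  have : ∫⁻ x, ⨅ k, f k x ∂μ = 0 := by
    refine le_antisymm (ge_of_tendsto' h fun k => ?_) zero_le
    exact lintegral_mono fun x => iInf_le _ k
  rwa [lintegral_eq_zero_iff (Measurable.iInf hf)] at this

variable {α β F : Type*} [MeasurableSpace α] [MeasurableSpace β] [NormedAddCommGroup F]
  {μ : Measure α} {ν : Measure β} [SFinite μ] [SFinite ν]

theorem ae_swap {m : Measure (α × β)} (e : m = μ.prod ν) {p : α × β → Prop}
    (h : ∀ᵐ z ∂m, p z) : ∀ᵐ b ∂ν, ∀ᵐ a ∂μ, p (a, b) := by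
  rw [e, ← Measure.prod_swap] at h
  exact Measure.ae_ae_of_ae_prod (ae_of_ae_map measurable_swap.aemeasurable h)

theorem lift_fst {m : Measure (α × β)} (e : m = μ.prod ν) {p : α → Prop}
    (h : ∀ᵐ a ∂μ, p a) : ∀ᵐ z ∂m, p z.1 := by
  rw [e]; exact Measure.quasiMeasurePreserving_fst.ae h

theorem lift_snd {m : Measure (α × β)} (e : m = μ.prod ν) {p : β → Prop}
    (h : ∀ᵐ b ∂ν, p b) : ∀ᵐ z ∂m, p z.2 := by
  rw [e]; exact Measure.quasiMeasurePreserving_snd.ae h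

theorem ae_fst {m : Measure (α × β)} (e : m = μ.prod ν) {p : α × β → Prop}
    (h : ∀ᵐ z ∂m, p z) : ∀ᵐ z ∂m, ∀ᵐ b ∂ν, p (z.1, b) := by
  refine lift_fst e (p := fun a => ∀ᵐ b ∂ν, p (a, b)) ?_
  rw [e] at h
  exact Measure.ae_ae_of_ae_prod h

theorem slice_right {m : Measure (α × β)} (e : m = μ.prod ν) (f : Lp F 2 m) :
    ∀ᵐ a ∂μ, MemLp (fun b => f (a, b)) 2 ν := by
  subst e
  have hm := (Lp.stronglyMeasurable f)
  have h : ∫⁻ a, ∫⁻ b, ‖f (a, b)‖ₑ ^ 2 ∂ν ∂μ < ⊤ := by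
    rw [← lintegral_prod (fun p => ‖f p‖ₑ ^ 2) (hm.enorm.pow_const 2).aemeasurable, Lp_lint_sq]
    exact ENNReal.pow_lt_top enorm_lt_top
  filter_upwards [ae_lt_top (hm.enorm.pow_const 2).lintegral_prod_right' h.ne] with a ha
  refine ⟨(hm.comp_measurable measurable_prodMk_left).aestronglyMeasurable, ?_⟩
  rw [lint_sq] at ha
  by_contra hc
  simp only [not_lt, top_le_iff] at hc
  simp [hc] at ha

theorem slice_left {m : Measure (α × β)} (e : m = μ.prod ν) (f : Lp F 2 m) :
    ∀ᵐ b ∂ν, MemLp (fun a => f (a, b)) 2 μ := by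
  subst e
  have hm := (Lp.stronglyMeasurable f)
  have h : ∫⁻ b, ∫⁻ a, ‖f (a, b)‖ₑ ^ 2 ∂μ ∂ν < ⊤ := by
    rw [← lintegral_prod_symm (fun p => ‖f p‖ₑ ^ 2) (hm.enorm.pow_const 2).aemeasurable, Lp_lint_sq]
    exact ENNReal.pow_lt_top enorm_lt_top
  filter_upwards [ae_lt_top (hm.enorm.pow_const 2).lintegral_prod_left' h.ne] with a ha
  refine ⟨(hm.comp_measurable measurable_prodMk_right).aestronglyMeasurable, ?_⟩
  rw [lint_sq] at ha
  by_contra hc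
  simp only [not_lt, top_le_iff] at hc
  simp [hc] at ha

theorem lint_symm {m : Measure (α × β)} (e : m = μ.prod ν) {f : α × β → ℝ≥0∞}
    (hf : Measurable f) : ∫⁻ z, f z ∂m = ∫⁻ b, ∫⁻ a, f (a, b) ∂μ ∂ν := by
  rw [e]; exact lintegral_prod_symm' f hf

theorem l1_sq_le [IsFiniteMeasure ν] {f : β → F} (hf : AEStronglyMeasurable f ν) :
    (∫⁻ b, ‖f b‖ₑ ∂ν) ^ 2 ≤ ν univ * ∫⁻ b, ‖f b‖ₑ ^ 2 ∂ν := by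
  have h := eLpNorm_le_eLpNorm_mul_rpow_measure_univ (p := 1) (q := 2) (by norm_num) hf
  rw [lint_sq, ← eLpNorm_one_eq_lintegral_enorm]
  calc _ ≤ _ := pow_le_pow_left' h 2
    _ = _ := by
      rw [mul_pow, mul_comm, ← ENNReal.rpow_natCast (_ ^ _), ← ENNReal.rpow_mul]
      norm_num

theorem volt_sq_le [IsFiniteMeasure ν] {m : Measure (α × β)} (e : m = μ.prod ν) (f : Lp F 2 m) :
    ∫⁻ p, (∫⁻ b, ‖f (p.1, b)‖ₑ ∂ν) ^ 2 ∂m ≤ (ν univ) ^ 2 * ‖f‖ₑ ^ 2 := by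
  subst e
  have hm := (Lp.stronglyMeasurable f)
  have m1 : Measurable fun a => ∫⁻ b, ‖f (a, b)‖ₑ ∂ν := hm.enorm.lintegral_prod_right'
  rw [lintegral_prod (fun p : α × β => (∫⁻ b, ‖f (p.1, b)‖ₑ ∂ν) ^ 2)
    ((m1.comp measurable_fst).pow_const 2).aemeasurable]
  simp only [lintegral_const]
  rw [lintegral_mul_const _ (m1.pow_const 2), ← Lp_lint_sq f,
    lintegral_prod _ (hm.enorm.pow_const 2).aemeasurable, pow_two, mul_comm, mul_assoc]
  gcongr
  rw [← lintegral_const_mul _ (hm.enorm.pow_const 2).lintegral_prod_right']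
  exact lintegral_mono fun a =>
    l1_sq_le (hm.comp_measurable measurable_prodMk_left).aestronglyMeasurable

theorem uIoc_sub {T a t : ℝ} (ha : a = 0 ∨ a = T) (ht : t ∈ Ioo 0 T) : uIoc a t ⊆ Ioc 0 T := by
  rcases ha with rfl | rfl
  · rw [uIoc_of_le ht.1.le]; exact Ioc_subset_Ioc_right ht.2.le
  · rw [uIoc_of_ge ht.2.le]; exact Ioc_subset_Ioc_left ht.1.le

theorem res_Ioo (T : ℝ) : (volume.restrict (Ioo 0 T) : Measure ℝ) = volume.restrict (Ioc 0 T) :=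
  Measure.restrict_congr_set Ioo_ae_eq_Ioc

variable [NormedSpace ℝ F]
theorem volt_congr {T a t : ℝ} (ha : a = 0 ∨ a = T) (ht : t ∈ Ioo 0 T) {f g : ℝ → F}
    (h : f =ᵐ[volume.restrict (Ioo 0 T)] g) : ∫ s in a..t, f s = ∫ s in a..t, g s := by
  rw [res_Ioo] at h
  refine intervalIntegral.integral_congr_ae ?_
  filter_upwards [(ae_restrict_iff' measurableSet_Ioc).1 h] with s hs hs'
  exact hs (uIoc_sub ha ht hs')

theorem volt_int {T a t : ℝ} (ha : a = 0 ∨ a = T) (ht : t ∈ Ioo 0 T) {f : ℝ → F}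
    (h : MemLp f 2 (volume.restrict (Ioo 0 T))) : IntervalIntegrable f volume a t := by
  rw [intervalIntegrable_iff]
  have := h.integrable (by norm_num)
  rw [res_Ioo] at this
  exact IntegrableOn.mono_set this (uIoc_sub ha ht)

theorem volt_le {T a t : ℝ} (ha : a = 0 ∨ a = T) (ht : t ∈ Ioo 0 T) (f : ℝ → F) :
    ‖∫ s in a..t, f s‖ₑ ≤ ∫⁻ s in Ioo 0 T, ‖f s‖ₑ := by
  rw [← enorm_norm, intervalIntegral.norm_integral_eq_norm_integral_uIoc, enorm_norm]
  refine (enorm_integral_le_lintegral_enorm _).trans ?_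
  rw [res_Ioo]
  exact lintegral_mono_set (uIoc_sub ha ht)

theorem res_cyl (Ω : Set (Pt n)) (a b : ℝ) : (volume.restrict (Ω ×ˢ Ioo a b) : Measure (Pt n × ℝ))
    = (volume.restrict Ω).prod (volume.restrict (Ioo a b)) := by
  rw [Measure.volume_eq_prod, Measure.prod_restrict]

theorem ae_time (Ω : Set (Pt n)) (a b : ℝ) :
    ∀ᵐ p ∂(volume.restrict (Ω ×ˢ Ioo a b) : Measure (Pt n × ℝ)), p.2 ∈ Ioo a b :=
  lift_snd (res_cyl Ω a b) (ae_restrict_mem measurableSet_Ioo)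
end aux

/-- With `Q = Ω × (0,T)` and an end point `a` of the time interval: the triple `w = (u, ∂ₜu, ∇ₓu)`
belongs to `L²(0,T; H¹₀(Ω)) ∩ H¹(0,T; L²(Ω))` with `u(·,a) = 0`.
* First part: for almost every `t`, `u(·,t) ∈ H¹₀(Ω)` with gradient `(∇ₓu)(·,t)`
  (and `∇ₓu ∈ L²(Q)`).
* Second part: `u(·,t) = ∫ₐᵗ ∂ₜu(·,s) ds`, with `∂ₜu ∈ L²(Q)`; that is, `u` is the absolutely
  continuous function of `t` with values in `L²(Ω)`, weak derivative `∂ₜu`, and `u(·,a) = 0`. -/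
def InH11 (Ω : Set (Pt n)) (T a : ℝ) (w : Jet (Ω ×ˢ Ioo 0 T)) : Prop :=
  (∀ᵐ t ∂volume.restrict (Ioo 0 T), ∃ z ∈ H10 Ω,
    (z.fst =ᵐ[volume.restrict Ω] fun x => w.fst (x, t)) ∧
    (z.snd =ᵐ[volume.restrict Ω] fun x => w.snd.snd (x, t))) ∧
  (∀ᵐ p ∂volume.restrict (Ω ×ˢ Ioo 0 T), w.fst p = ∫ s in a..p.2, w.snd.fst (p.1, s))

/-- The anisotropic Sobolev space of the triples `(u, ∂ₜu, ∇ₓu)` with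
`u ∈ L²(0,T; H¹₀(Ω)) ∩ H¹(0,T; L²(Ω))`, `u(·,a) = 0`. It is `H^{1,1}_{0;0,}(Q)` for `a = 0` and
`H^{1,1}_{0;,0}(Q)` for `a = T`. -/
def H11 (Ω : Set (Pt n)) (T a : ℝ) (ha : a = 0 ∨ a = T) : Submodule ℝ (Jet (Ω ×ˢ Ioo 0 T)) where
  carrier := {w | InH11 Ω T a w}
  zero_mem' := by
    have e := res_cyl Ω 0 T
    have z1 := Lp.coeFn_zero ℝ 2 (volume.restrict (Ω ×ˢ Ioo 0 T))
    have z2 := Lp.coeFn_zero (Pt n) 2 (volume.restrict (Ω ×ˢ Ioo 0 T))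
    constructor
    · filter_upwards [ae_swap e z1, ae_swap e z2] with t h1 h2
      refine ⟨0, zero_mem _, ?_, ?_⟩
      · filter_upwards [Lp.coeFn_zero ℝ 2 (volume.restrict Ω), h1] with x k1 k2
        simp only [WithLp.zero_fst] at k2 ⊢
        rw [k1]; exact k2.symm
      · filter_upwards [Lp.coeFn_zero (Pt n) 2 (volume.restrict Ω), h2] with x k1 k2
        simp only [WithLp.zero_snd] at k2 ⊢
        rw [k1]; exact k2.symm
    · have q1 := ae_fst e z1
      have q2 := ae_time Ω 0 T
      filter_upwards [z1, q1, q2] with p k1 k2 k3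
      simp only [WithLp.zero_snd, WithLp.zero_fst]
      rw [k1, volt_congr ha k3 k2]
      simp
  add_mem' := by
    rintro v w ⟨h1, h2⟩ ⟨k1, k2⟩
    have e := res_cyl Ω 0 T
    have z1 := Lp.coeFn_add v.fst w.fst
    have z2 := Lp.coeFn_add v.snd.fst w.snd.fst
    have z3 := Lp.coeFn_add v.snd.snd w.snd.snd
    constructor
    · filter_upwards [h1, k1, ae_swap e z1, ae_swap e z3] with t ⟨y, hy, r1, r2⟩ ⟨z, hz, s1, s2⟩ l1 l2
      refine ⟨y + z, add_mem hy hz, ?_, ?_⟩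
      · filter_upwards [Lp.coeFn_add y.fst z.fst, l1, r1, s1] with x a b c d
        simp only [WithLp.add_fst] at b ⊢
        rw [a, b, Pi.add_apply, Pi.add_apply, c, d]
      · filter_upwards [Lp.coeFn_add y.snd z.snd, l2, r2, s2] with x a b c d
        simp only [WithLp.add_snd] at b ⊢
        rw [a, b, Pi.add_apply, Pi.add_apply, c, d]
    · have q1 := ae_fst e z2
      have q2 := ae_time Ω 0 T
      have q3 := lift_fst e (slice_right e v.snd.fst)
      have q4 := lift_fst e (slice_right e w.snd.fst)
      filter_upwards [z1, q1, q2, q3, q4, h2, k2] with p a1 a2 a3 a4 a5 a6 a7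
      simp only [WithLp.add_snd, WithLp.add_fst]
      rw [a1, volt_congr ha a3 a2]
      simp only [Pi.add_apply]
      rw [intervalIntegral.integral_add (volt_int ha a3 a4) (volt_int ha a3 a5), a6, a7]
  smul_mem' := by
    rintro r w ⟨k1, k2⟩
    have e := res_cyl Ω 0 T
    have z1 := Lp.coeFn_smul r w.fst
    have z2 := Lp.coeFn_smul r w.snd.fst
    have z3 := Lp.coeFn_smul r w.snd.snd
    constructor
    · filter_upwards [k1, ae_swap e z1, ae_swap e z3] with t ⟨z, hz, s1, s2⟩ l1 l2
      refine ⟨r • z, Submodule.smul_mem _ _ hz, ?_, ?_⟩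
      · filter_upwards [Lp.coeFn_smul r z.fst, l1, s1] with x a b d
        simp only [WithLp.smul_fst] at b ⊢
        rw [a, b, Pi.smul_apply, Pi.smul_apply, d]
      · filter_upwards [Lp.coeFn_smul r z.snd, l2, s2] with x a b d
        simp only [WithLp.smul_snd] at b ⊢
        rw [a, b, Pi.smul_apply, Pi.smul_apply, d]
    · have q1 := ae_fst e z2
      have q2 := ae_time Ω 0 T
      filter_upwards [z1, q1, q2, k2] with p a1 a2 a3 a7
      simp only [WithLp.smul_snd, WithLp.smul_fst]
      rw [a1, volt_congr ha a3 a2]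
      simp only [Pi.smul_apply]
      rw [intervalIntegral.integral_smul, a7]

/-- Poincaré inequality in time. -/
theorem H11_poincare {Ω : Set (Pt n)} {T a : ℝ} {ha : a = 0 ∨ a = T} {w : Jet (Ω ×ˢ Ioo 0 T)}
    (hw : w ∈ H11 Ω T a ha) : ‖w.fst‖ₑ ^ 2 ≤ (ENNReal.ofReal T) ^ 2 * ‖w.snd.fst‖ₑ ^ 2 := by
  have e := res_cyl Ω 0 T
  have q2 := ae_time Ω 0 T
  have := volt_sq_le e w.snd.fst
  simp only [Measure.restrict_apply_univ, Real.volume_Ioo, sub_zero] at this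
  refine le_trans ?_ this
  rw [← Lp_lint_sq]
  refine lintegral_mono_ae ?_
  filter_upwards [And.right (show InH11 Ω T a w from hw), q2] with p h1 h2
  rw [h1]
  gcongr
  exact volt_le ha h2 _

theorem enorm_sq_prod {E F : Type*} [NormedAddCommGroup E] [NormedAddCommGroup F]
    (w : WithLp 2 (E × F)) : ‖w‖ₑ ^ 2 = ‖w.fst‖ₑ ^ 2 + ‖w.snd‖ₑ ^ 2 := by
  have := WithLp.prod_norm_sq_eq_of_L2 w
  rw [← ofReal_norm, ← ofReal_norm, ← ofReal_norm, ← ENNReal.ofReal_pow (norm_nonneg _),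
    ← ENNReal.ofReal_pow (norm_nonneg _), ← ENNReal.ofReal_pow (norm_nonneg _), this,
    ENNReal.ofReal_add (by positivity) (by positivity)]

theorem tendsto_enorm_sq {E : Type*} [NormedAddCommGroup E] {u : ℕ → E} {x : E}
    (h : Tendsto u atTop (𝓝 x)) : Tendsto (fun k => ‖x - u k‖ₑ ^ 2) atTop (𝓝 0) := by
  have : Tendsto (fun k => x - u k) atTop (𝓝 (x - x)) := tendsto_const_nhds.sub h
  have := (this.enorm).ennrpow_const 2
  simpa using this

theorem H11_isClosed (Ω : Set (Pt n)) (T a : ℝ) (ha : a = 0 ∨ a = T) :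
    IsClosed (H11 Ω T a ha : Set (Jet (Ω ×ˢ Ioo 0 T))) := by
  refine IsSeqClosed.isClosed ?_
  intro u w hu hlim
  have e := res_cyl Ω 0 T
  have l1 : Tendsto (fun k => (u k).fst) atTop (𝓝 w.fst) :=
    ((WithLp.fstL 2 ℝ _ _).continuous.tendsto w).comp hlim
  have l2 : Tendsto (fun k => (u k).snd) atTop (𝓝 w.snd) :=
    ((WithLp.sndL 2 ℝ _ _).continuous.tendsto w).comp hlim
  have l3 : Tendsto (fun k => (u k).snd.fst) atTop (𝓝 w.snd.fst) :=
    ((WithLp.fstL 2 ℝ _ _).continuous.tendsto w.snd).comp l2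
  have l4 : Tendsto (fun k => (u k).snd.snd) atTop (𝓝 w.snd.snd) :=
    ((WithLp.sndL 2 ℝ _ _).continuous.tendsto w.snd).comp l2
  have t1 := tendsto_enorm_sq l1
  have t3 := tendsto_enorm_sq l3
  have t4 := tendsto_enorm_sq l4
  have q2 := ae_time Ω 0 T
  have s1 : ∀ k, _ := fun k => Lp.coeFn_sub w.fst (u k).fst
  have s3 : ∀ k, _ := fun k => Lp.coeFn_sub w.snd.fst (u k).snd.fst
  have s4 : ∀ k, _ := fun k => Lp.coeFn_sub w.snd.snd (u k).snd.snd
  have hu : ∀ k, InH11 Ω T a (u k) := hu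
  show InH11 Ω T a w
  constructor
  · have m1 : ∀ k, Measurable fun p => ‖(w.fst - (u k).fst) p‖ₑ ^ 2 := fun k =>
      (Lp.stronglyMeasurable (w.fst - (u k).fst)).enorm.pow_const 2
    have m4 : ∀ k, Measurable fun p => ‖(w.snd.snd - (u k).snd.snd) p‖ₑ ^ 2 := fun k =>
      (Lp.stronglyMeasurable (w.snd.snd - (u k).snd.snd)).enorm.pow_const 2
    have M1 : ∀ k, Measurable fun t => ∫⁻ x, ‖(w.fst - (u k).fst) (x, t)‖ₑ ^ 2
      ∂volume.restrict Ω := fun k => (m1 k).lintegral_prod_left'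
    have M4 : ∀ k, Measurable fun t => ∫⁻ x, ‖(w.snd.snd - (u k).snd.snd) (x, t)‖ₑ ^ 2
      ∂volume.restrict Ω := fun k => (m4 k).lintegral_prod_left'
    have inf := ae_iInf (μ := volume.restrict (Ioo 0 T)) (f := fun k t =>
      (∫⁻ x, ‖(w.fst - (u k).fst) (x, t)‖ₑ ^ 2 ∂volume.restrict Ω) +
      ∫⁻ x, ‖(w.snd.snd - (u k).snd.snd) (x, t)‖ₑ ^ 2 ∂volume.restrict Ω)
      (fun k => (M1 k).add (M4 k)) (by
        have := t1.add t4
        simp only [add_zero] at this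
        refine this.congr fun k => ?_
        rw [lintegral_add_left (M1 k), ← Lp_lint_sq, ← Lp_lint_sq]
        congr 1
        · exact lint_symm e (m1 k)
        · exact lint_symm e (m4 k))
    have hu1 := ae_all_iff.2 fun k => (hu k).1
    have S1 := ae_all_iff.2 fun k => ae_swap e (s1 k)
    have S4 := ae_all_iff.2 fun k => ae_swap e (s4 k)
    filter_upwards [inf, hu1, S1, S4, slice_left e w.fst, slice_left e w.snd.snd]
      with t inf hu1 S1 S4 f1 f4
    refine ⟨WithLp.toLp 2 (f1.toLp, f4.toLp), ?_, f1.coeFn_toLp, f4.coeFn_toLp⟩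
    refine (isClosed_closure.closure_eq.le :
      closure (H10 Ω : Set (Graph Ω)) ⊆ H10 Ω) (EMetric.mem_closure_iff.2 fun ε hε => ?_)
    have : (⨅ k, _) < ε ^ 2 := inf.trans_lt (ENNReal.pow_pos hε 2)
    obtain ⟨k, hk⟩ := iInf_lt_iff.1 this
    obtain ⟨z, hz, z1, z2⟩ := hu1 k
    refine ⟨z, hz, ?_⟩
    rw [edist_eq_enorm_sub]
    refine lt_of_pow_lt_pow_left' 2 (lt_of_eq_of_lt ?_ hk)
    rw [enorm_sq_prod, ← Lp_lint_sq, ← Lp_lint_sq]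
    congr 1
    · refine lintegral_congr_ae ?_
      filter_upwards [S1 k, z1, f1.coeFn_toLp, Lp.coeFn_sub f1.toLp z.fst] with x a b c d
      rw [a]
      change ‖(f1.toLp - z.fst) x‖ₑ ^ 2 = _
      rw [d, Pi.sub_apply, Pi.sub_apply, b, c]
    · refine lintegral_congr_ae ?_
      filter_upwards [S4 k, z2, f4.coeFn_toLp, Lp.coeFn_sub f4.toLp z.snd] with x a b c d
      rw [a]
      change ‖(f4.toLp - z.snd) x‖ₑ ^ 2 = _
      rw [d, Pi.sub_apply, Pi.sub_apply, b, c]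
  · have m1 : ∀ k, Measurable fun p => ‖(w.fst - (u k).fst) p‖ₑ ^ 2 := fun k =>
      (Lp.stronglyMeasurable (w.fst - (u k).fst)).enorm.pow_const 2
    have m2 : ∀ k, Measurable fun p : Pt n × ℝ =>
        (∫⁻ s in Ioo 0 T, ‖(w.snd.fst - (u k).snd.fst) (p.1, s)‖ₑ) ^ 2 := fun k =>
      (((Lp.stronglyMeasurable (w.snd.fst - (u k).snd.fst)).enorm.lintegral_prod_right').comp
        measurable_fst).pow_const 2
    have inf := ae_iInf (μ := volume.restrict (Ω ×ˢ Ioo 0 T)) (f := fun k p =>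
      ‖(w.fst - (u k).fst) p‖ₑ ^ 2 +
        (∫⁻ s in Ioo 0 T, ‖(w.snd.fst - (u k).snd.fst) (p.1, s)‖ₑ) ^ 2)
      (fun k => (m1 k).add (m2 k)) (by
        have := t1.add (ENNReal.Tendsto.const_mul (a := ENNReal.ofReal T ^ 2) t3 (Or.inr (by simp)))
        simp only [add_zero, mul_zero] at this
        refine tendsto_of_tendsto_of_tendsto_of_le_of_le tendsto_const_nhds this
          (fun _ => zero_le) fun k => ?_
        beta_reduce
        rw [lintegral_add_left (m1 k), Lp_lint_sq]
        gcongr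
        have := volt_sq_le e (w.snd.fst - (u k).snd.fst)
        simpa only [Measure.restrict_apply_univ, Real.volume_Ioo, sub_zero] using this)
    have hu2 := ae_all_iff.2 fun k => (hu k).2
    have S1 := ae_all_iff.2 s1
    have S3 := ae_all_iff.2 fun k => ae_fst e (s3 k)
    have f3 := lift_fst e (slice_right e w.snd.fst)
    have g3 := ae_all_iff.2 fun k =>
      lift_fst e (slice_right e (u k).snd.fst)
    filter_upwards [inf, hu2, S1, S3, f3, g3, q2] with p inf hu2 S1 S3 f3 g3 q2
    rw [← sub_eq_zero, ← enorm_eq_zero]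
    refine le_antisymm (le_of_forall_pos_lt_add' ?_) zero_le
    intro ε hε
    have : (⨅ k, _) < (ε / 2) ^ 2 := inf.trans_lt (ENNReal.pow_pos (ENNReal.half_pos hε.ne') 2)
    obtain ⟨k, hk⟩ := iInf_lt_iff.1 this
    have k1 := lt_of_pow_lt_pow_left' 2 (lt_of_le_of_lt le_self_add hk)
    have k2 := lt_of_pow_lt_pow_left' 2 (lt_of_le_of_lt le_add_self hk)
    rw [zero_add, ← ENNReal.add_halves ε]
    refine lt_of_le_of_lt ?_ (ENNReal.add_lt_add k1 k2)
    have key : w.fst p - (∫ s in a..p.2, w.snd.fst (p.1, s)) =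
        (w.fst - (u k).fst) p - ∫ s in a..p.2, (w.snd.fst - (u k).snd.fst) (p.1, s) := by
      rw [volt_congr ha q2 (S3 k), S1 k]
      simp only [Pi.sub_apply]
      rw [intervalIntegral.integral_sub (volt_int ha q2 f3) (volt_int ha q2 (g3 k)), hu2 k]
      ring
    rw [key]
    refine enorm_sub_le.trans ?_
    gcongr
    exact volt_le ha q2 _

instance (Ω : Set (Pt n)) (T a : ℝ) (ha : a = 0 ∨ a = T) : CompleteSpace (H11 Ω T a ha) :=
  (H11_isClosed Ω T a ha).completeSpace_coe

/-- The test space `Y = H^{1,1}_{0;,0}(Q)` (zero lateral and zero terminal values), whose elements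
are the triples `(q, ∂ₜq, ∇ₓq)`. The full `H¹(Q)` norm used here is equivalent to `|q|_{H¹(Q)}`; the
energy product of `∂ₜ` and `∇ₓ` is `aForm` below. -/
def Y (Ω : Set (Pt n)) (T : ℝ) : Type := H11 Ω T T (Or.inr rfl)

instance (Ω : Set (Pt n)) (T : ℝ) : NormedAddCommGroup (Y Ω T) :=
  inferInstanceAs (NormedAddCommGroup (H11 Ω T T (Or.inr rfl)))
instance (Ω : Set (Pt n)) (T : ℝ) : InnerProductSpace ℝ (Y Ω T) :=
  inferInstanceAs (InnerProductSpace ℝ (H11 Ω T T (Or.inr rfl)))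
instance (Ω : Set (Pt n)) (T : ℝ) : CompleteSpace (Y Ω T) :=
  inferInstanceAs (CompleteSpace (H11 Ω T T (Or.inr rfl)))

/-- The inclusion `q ↦ (q, ∂ₜq, ∇ₓq)`. -/
def Y.jet (Ω : Set (Pt n)) (T : ℝ) : Y Ω T →L[ℝ] Jet (Ω ×ˢ Ioo 0 T) :=
  (H11 Ω T T (Or.inr rfl)).subtypeL

/-- The map `q ↦ (∂ₜq, ∇ₓq)`. -/
def Y.grad (Ω : Set (Pt n)) (T : ℝ) :
    Y Ω T →L[ℝ] WithLp 2 (L2 (Ω ×ˢ Ioo 0 T) × L2vec (Ω ×ˢ Ioo 0 T)) :=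
  (WithLp.sndL 2 ℝ _ _).comp (Y.jet Ω T)

/-- `⟨∂ₜw, ∂ₜq⟩ + ⟨∇ₓw, ∇ₓq⟩` on `Y`. -/
def aForm (Ω : Set (Pt n)) (T : ℝ) : Y Ω T →L[ℝ] Y Ω T →L[ℝ] ℝ :=
  (innerSL ℝ).bilinearComp (Y.grad Ω T) (Y.grad Ω T)

theorem aForm_apply (Ω : Set (Pt n)) (T : ℝ) (w q : Y Ω T) : aForm Ω T w q =
    inner ℝ w.1.snd.fst q.1.snd.fst + inner ℝ w.1.snd.snd q.1.snd.snd :=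
  WithLp.prod_inner_apply w.1.snd q.1.snd

theorem aForm_coercive (Ω : Set (Pt n)) (T : ℝ) : IsCoercive (aForm Ω T) := by
  refine ⟨1 / (1 + T ^ 2), by positivity, fun u => ?_⟩
  have h := H11_poincare u.2
  have h' : ‖u.1.fst‖ ^ 2 ≤ T ^ 2 * ‖u.1.snd.fst‖ ^ 2 := by
    have h2 := ENNReal.toReal_mono (by finiteness) h
    rw [ENNReal.toReal_pow, toReal_enorm, ENNReal.toReal_mul, ENNReal.toReal_pow,
      ENNReal.toReal_pow, toReal_enorm, ENNReal.toReal_ofReal'] at h2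
    refine h2.trans ?_
    gcongr ?_ * _
    rcases le_total T 0 with h | h
    · rw [max_eq_right h]; nlinarith [sq_nonneg T]
    · rw [max_eq_left h]
  have n1 := WithLp.prod_norm_sq_eq_of_L2 u.1
  have n2 := WithLp.prod_norm_sq_eq_of_L2 u.1.snd
  rw [aForm_apply, real_inner_self_eq_norm_sq, real_inner_self_eq_norm_sq, mul_assoc, ← pow_two,
    div_mul_eq_mul_div, one_mul, div_le_iff₀ (by positivity)]
  change ‖u.1‖ ^ 2 ≤ _
  rw [n1, n2]
  nlinarith [sq_nonneg T, mul_nonneg (sq_nonneg T) (sq_nonneg ‖u.1.snd.snd‖)]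

/-- The isomorphism `V → V*` given by a coercive bounded bilinear form. -/
def laxEquiv {V : Type*} [NormedAddCommGroup V] [InnerProductSpace ℝ V] [CompleteSpace V]
    {b : V →L[ℝ] V →L[ℝ] ℝ} (hb : IsCoercive b) : V ≃L[ℝ] StrongDual ℝ V :=
  hb.continuousLinearEquivOfBilin.trans (InnerProductSpace.toDual ℝ V).toContinuousLinearEquiv

theorem laxEquiv_apply {V : Type*} [NormedAddCommGroup V] [InnerProductSpace ℝ V] [CompleteSpace V]
    {b : V →L[ℝ] V →L[ℝ] ℝ} (hb : IsCoercive b) (v w : V) : laxEquiv hb v w = b v w :=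
  hb.continuousLinearEquivOfBilin_apply v w

/-- The isomorphism `A : Y → Y*`, `⟨Aw, q⟩ = ⟨∂ₜw, ∂ₜq⟩ + ⟨∇ₓw, ∇ₓq⟩`; see `A_apply`. -/
def A (Ω : Set (Pt n)) (T : ℝ) : Y Ω T ≃L[ℝ] StrongDual ℝ (Y Ω T) :=
  laxEquiv (aForm_coercive Ω T)

theorem A_apply (Ω : Set (Pt n)) (T : ℝ) (w q : Y Ω T) : A Ω T w q =
    inner ℝ w.1.snd.fst q.1.snd.fst + inner ℝ w.1.snd.snd q.1.snd.snd := by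
  rw [← aForm_apply]
  exact laxEquiv_apply (aForm_coercive Ω T) w q

theorem map_abs_le (T : ℝ) : (volume.restrict (Ioo (-T) T)).map (fun t : ℝ => |t|) ≤
    (2 : ℝ≥0∞) • volume.restrict (Ioo 0 T) := by
  refine Measure.le_iff.2 fun s hs => ?_
  have m : Measurable fun t : ℝ => |t| := measurable_norm
  rw [Measure.map_apply m hs, Measure.restrict_apply (m hs), Measure.smul_apply,
    Measure.restrict_apply hs]
  have sub : (fun t : ℝ => |t|) ⁻¹' s ∩ Ioo (-T) T ⊆
      ({0} ∪ (s ∩ Ioo 0 T)) ∪ (fun t => -t) ⁻¹' (s ∩ Ioo 0 T) := by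
    rintro t ⟨h1, h2⟩
    rcases lt_trichotomy t 0 with h | h | h
    · right
      simp only [mem_preimage, abs_of_neg h] at h1
      exact ⟨h1, by linarith, by linarith [h2.1]⟩
    · left; left; exact h
    · left; right
      simp only [mem_preimage, abs_of_pos h] at h1
      exact ⟨h1, h, h2.2⟩
  refine (measure_mono sub).trans ((measure_union_le _ _).trans ?_)
  refine (add_le_add (measure_union_le _ _) le_rfl).trans ?_
  have := (Measure.measurePreserving_neg (volume : Measure ℝ)).measure_preimage
    (s := s ∩ Ioo 0 T) (hs.inter measurableSet_Ioo).nullMeasurableSet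
  rw [this]
  simp [two_mul]

theorem map_refl_le (Ω : Set (Pt n)) (T : ℝ) :
    (volume.restrict (Ω ×ˢ Ioo (-T) T)).map (fun p : Pt n × ℝ => (p.1, |p.2|)) ≤
    (2 : ℝ≥0∞) • volume.restrict (Ω ×ˢ Ioo 0 T) := by
  have m : Measurable fun t : ℝ => |t| := measurable_norm
  rw [res_cyl, res_cyl]
  have h := Measure.map_prod_map (volume.restrict Ω) (volume.restrict (Ioo (-T) T)) measurable_id m
  have h2 : Prod.map id (fun t : ℝ => |t|) = fun p : Pt n × ℝ => (p.1, |p.2|) := rfl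
  rw [h2] at h
  rw [← h, Measure.map_id]
  refine (Measure.prod_mono le_rfl (map_abs_le T)).trans ?_
  rw [Measure.prod_smul_right]

section refl
variable {F : Type*} [NormedAddCommGroup F] [NormedSpace ℝ F]

/-- `(x,t) ↦ f(x,t)` for `t ≥ 0` and `(x,t) ↦ σ f(x,-t)` for `t < 0`. -/
def reflFun (σ : ℝ) (f : Pt n × ℝ → F) (p : Pt n × ℝ) : F :=
  (if p.2 < 0 then σ else 1) • f (p.1, |p.2|)

theorem meas_refl : Measurable (fun p : Pt n × ℝ => (p.1, |p.2|)) :=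
  measurable_fst.prodMk (measurable_norm.comp measurable_snd)

theorem reflFun_ae (Ω : Set (Pt n)) (T : ℝ) {p : Pt n × ℝ → Prop}
    (h : ∀ᵐ z ∂volume.restrict (Ω ×ˢ Ioo 0 T), p z) :
    ∀ᵐ z ∂volume.restrict (Ω ×ˢ Ioo (-T) T), p (z.1, |z.2|) := by
  have h1 : (volume.restrict (Ω ×ˢ Ioo (-T) T)).map (fun p : Pt n × ℝ => (p.1, |p.2|)) ≪
      volume.restrict (Ω ×ˢ Ioo 0 T) :=
    (map_refl_le Ω T).absolutelyContinuous.trans (Measure.smul_absolutelyContinuous)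
  exact ae_of_ae_map meas_refl.aemeasurable (h1.ae_le h)

theorem reflFun_memLp (Ω : Set (Pt n)) (T : ℝ) {σ : ℝ} (hσ : |σ| ≤ 1)
    (f : Lp F 2 (volume.restrict (Ω ×ˢ Ioo 0 T))) :
    AEStronglyMeasurable (reflFun σ f) (volume.restrict (Ω ×ˢ Ioo (-T) T)) ∧
    eLpNorm (reflFun σ f) 2 (volume.restrict (Ω ×ˢ Ioo (-T) T)) ≤ 2 * ‖f‖ₑ := by
  have hs : StronglyMeasurable fun p : Pt n × ℝ => f (p.1, |p.2|) :=
    (Lp.stronglyMeasurable f).comp_measurable meas_refl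
  refine ⟨?_, ?_⟩
  · refine StronglyMeasurable.aestronglyMeasurable ?_
    exact (StronglyMeasurable.ite (measurableSet_lt measurable_snd measurable_const)
      stronglyMeasurable_const stronglyMeasurable_const).smul hs
  · calc eLpNorm (reflFun σ f) 2 (volume.restrict (Ω ×ˢ Ioo (-T) T))
        ≤ eLpNorm (fun p : Pt n × ℝ => f (p.1, |p.2|)) 2
          (volume.restrict (Ω ×ˢ Ioo (-T) T)) := by
            refine eLpNorm_mono fun p => ?_
            unfold reflFun
            rw [norm_smul]
            refine mul_le_of_le_one_left (norm_nonneg _) ?_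
            split_ifs
            · exact hσ
            · simp
      _ = eLpNorm f 2 ((volume.restrict (Ω ×ˢ Ioo (-T) T)).map
          (fun p : Pt n × ℝ => (p.1, |p.2|))) :=
        (eLpNorm_map_measure (Lp.stronglyMeasurable f).aestronglyMeasurable
          meas_refl.aemeasurable).symm
      _ ≤ eLpNorm f 2 ((2 : ℝ≥0∞) • volume.restrict (Ω ×ˢ Ioo 0 T)) :=
        eLpNorm_mono_measure _ (map_refl_le Ω T)
      _ ≤ _ := by
        rw [eLpNorm_smul_measure_of_ne_zero (by norm_num), Lp.enorm_def, smul_eq_mul]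
        gcongr
        calc (2 : ℝ≥0∞) ^ (1 / (2 : ℝ≥0∞)).toReal ≤ 2 ^ (1 : ℝ) :=
              ENNReal.rpow_le_rpow_of_exponent_le (by norm_num) (by norm_num)
          _ = 2 := by simp

theorem reflFun_mem (Ω : Set (Pt n)) (T : ℝ) {σ : ℝ} (hσ : |σ| ≤ 1)
    (f : Lp F 2 (volume.restrict (Ω ×ˢ Ioo 0 T))) :
    MemLp (reflFun σ f) 2 (volume.restrict (Ω ×ˢ Ioo (-T) T)) :=
  ⟨(reflFun_memLp Ω T hσ f).1, (reflFun_memLp Ω T hσ f).2.trans_lt (by finiteness)⟩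

/-- The map `reflFun σ` from `L²(Q)` to `L²(Ω × (-T,T))`. -/
def reflLp (Ω : Set (Pt n)) (T : ℝ) (σ : ℝ) (hσ : |σ| ≤ 1) :
    Lp F 2 (volume.restrict (Ω ×ˢ Ioo 0 T)) →L[ℝ]
      Lp F 2 (volume.restrict (Ω ×ˢ Ioo (-T) T)) :=
  LinearMap.mkContinuous
    { toFun := fun f => (reflFun_mem Ω T hσ f).toLp
      map_add' := fun f g => by
        rw [← MemLp.toLp_add, MemLp.toLp_eq_toLp_iff]
        filter_upwards [reflFun_ae Ω T (Lp.coeFn_add f g)] with p h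
        simp only [reflFun, h, Pi.add_apply, smul_add]
      map_smul' := fun c f => by
        rw [RingHom.id_apply, ← MemLp.toLp_const_smul, MemLp.toLp_eq_toLp_iff]
        filter_upwards [reflFun_ae Ω T (Lp.coeFn_smul c f)] with p h
        simp only [reflFun, h, Pi.smul_apply]
        rw [smul_comm] }
    2 (fun f => by
      change ‖(reflFun_mem Ω T hσ f).toLp‖ ≤ _
      rw [Lp.norm_toLp]
      have := ENNReal.toReal_mono (by finiteness) (reflFun_memLp Ω T hσ f).2
      rwa [ENNReal.toReal_mul, toReal_enorm] at this)

theorem reflLp_ae (Ω : Set (Pt n)) (T : ℝ) (σ : ℝ) (hσ : |σ| ≤ 1)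
    (f : Lp F 2 (volume.restrict (Ω ×ˢ Ioo 0 T))) :
    reflLp Ω T σ hσ f =ᵐ[volume.restrict (Ω ×ˢ Ioo (-T) T)] reflFun σ f :=
  (reflFun_mem Ω T hσ f).coeFn_toLp
end refl

/-- Reflection in time with respect to `t = 0`: the function `q` becomes `q(x,|t|)`, so that `∂ₜq`
is reflected as an odd function, and `∇ₓq` as an even one. -/
def reflJet (Ω : Set (Pt n)) (T : ℝ) : Jet (Ω ×ˢ Ioo 0 T) →L[ℝ] Jet (Ω ×ˢ Ioo (-T) T) :=
  let D := Ω ×ˢ Ioo 0 T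
  let D' := Ω ×ˢ Ioo (-T) T
  let p₁ : Jet D →L[ℝ] L2 D := WithLp.fstL 2 ℝ _ _
  let p₂ : Jet D →L[ℝ] WithLp 2 (L2 D × L2vec D) := WithLp.sndL 2 ℝ _ _
  let p₂₁ : Jet D →L[ℝ] L2 D := (WithLp.fstL 2 ℝ _ _).comp p₂
  let p₂₂ : Jet D →L[ℝ] L2vec D := (WithLp.sndL 2 ℝ _ _).comp p₂
  let even₁ : L2 D →L[ℝ] L2 D' := reflLp Ω T 1 (by simp)
  let odd₁ : L2 D →L[ℝ] L2 D' := reflLp Ω T (-1) (by simp)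
  let even₂ : L2vec D →L[ℝ] L2vec D' := reflLp Ω T 1 (by simp)
  let g : Jet D →L[ℝ] WithLp 2 (L2 D' × L2vec D') :=
    (WithLp.prodContinuousLinearEquiv 2 ℝ (L2 D') (L2vec D')).symm.toContinuousLinearMap.comp
      ((odd₁.comp p₂₁).prod (even₂.comp p₂₂))
  (WithLp.prodContinuousLinearEquiv 2 ℝ (L2 D')
    (WithLp 2 (L2 D' × L2vec D'))).symm.toContinuousLinearMap.comp ((even₁.comp p₁).prod g)

theorem reflJet_apply (Ω : Set (Pt n)) (T : ℝ) (w : Jet (Ω ×ˢ Ioo 0 T)) :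
    (reflJet Ω T w).fst = reflLp Ω T 1 (by simp) w.fst ∧
    (reflJet Ω T w).snd.fst = reflLp Ω T (-1) (by simp) w.snd.fst ∧
    (reflJet Ω T w).snd.snd = reflLp Ω T 1 (by simp) w.snd.snd :=
  ⟨rfl, rfl, rfl⟩

/-- `H¹₀(Q₋)`, `Q₋ = Ω × (-T,T)`, whose elements are the triples `(w, ∂ₜw, ∇ₓw)`. -/
def H10Q (Ω : Set (Pt n)) (T : ℝ) : Type := H10st (Ω ×ˢ Ioo (-T) T)

instance (Ω : Set (Pt n)) (T : ℝ) : NormedAddCommGroup (H10Q Ω T) :=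
  inferInstanceAs (NormedAddCommGroup (H10st (Ω ×ˢ Ioo (-T) T)))
instance (Ω : Set (Pt n)) (T : ℝ) : InnerProductSpace ℝ (H10Q Ω T) :=
  inferInstanceAs (InnerProductSpace ℝ (H10st (Ω ×ˢ Ioo (-T) T)))
instance (Ω : Set (Pt n)) (T : ℝ) : CompleteSpace (H10Q Ω T) :=
  inferInstanceAs (CompleteSpace (H10st (Ω ×ˢ Ioo (-T) T)))

/-- The inclusion `w ↦ (w, ∂ₜw, ∇ₓw)`. -/
def H10Q.jet (Ω : Set (Pt n)) (T : ℝ) : H10Q Ω T →L[ℝ] Jet (Ω ×ˢ Ioo (-T) T) :=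
  (H10st (Ω ×ˢ Ioo (-T) T)).subtypeL

/-- The orthogonal projection onto the closed subspace `H¹₀(Q₋)`, the identity on `H¹₀(Q₋)`. -/
def H10Q.proj (Ω : Set (Pt n)) (T : ℝ) : Jet (Ω ×ˢ Ioo (-T) T) →L[ℝ] H10Q Ω T :=
  (H10st (Ω ×ˢ Ioo (-T) T)).orthogonalProjectionOnto

/-- The extension operator `𝓔 : Y → H¹₀(Q₋)`, reflection in time with respect to `t = 0`. For
`q ∈ Y` the reflected function belongs to `H¹₀(Q₋)`, since `q` vanishes on the lateral boundary and
at `t = T`; hence the projection, which provides the codomain, leaves it unchanged. -/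
def extend (Ω : Set (Pt n)) (T : ℝ) : Y Ω T →L[ℝ] H10Q Ω T :=
  (H10Q.proj Ω T).comp ((reflJet Ω T).comp (Y.jet Ω T))

theorem box_integrable {D D' : Set (Pt n × ℝ)} {φ : Pt n × ℝ → ℝ} (hφ : IsTest D' φ) (u : L2 D) :
    Integrable (fun p => u p * box φ p) (volume.restrict D) := by
  have c : Continuous (iteratedFDeriv ℝ 2 φ) := 
    (contDiff_infty.1 hφ.1 2).continuous_iteratedFDeriv'
  have cb : Continuous (box φ) := by unfold box; fun_prop
  have cs : HasCompactSupport (box φ) := by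
    refine (hφ.2.1.iteratedFDeriv (𝕜 := ℝ) 2).mono fun p hp h0 => hp ?_
    unfold box
    rw [h0]
    simp
  have hb : MemLp (box φ) 2 (volume.restrict D) :=
    (cb.memLp_of_hasCompactSupport cs (p := 2) (μ := volume)).restrict D
  exact MemLp.integrable_mul (p := 2) (q := 2) (Lp.memLp u) hb

/-- `ℓ ∈ [H¹₀(Q₋)]*` is the distribution `□ũ` on `Q₋`, where `ũ` is the extension of `u` by zero:
`ℓ(φ) = ∫_Q u □φ` for all `φ ∈ C_c^∞(Q₋)`. As `C_c^∞(Q₋)` is dense, `ℓ` is unique. -/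
def IsBox (Ω : Set (Pt n)) (T : ℝ) (u : L2 (Ω ×ˢ Ioo 0 T)) (ℓ : StrongDual ℝ (H10Q Ω T)) : Prop :=
  ∀ φ : Pt n × ℝ → ℝ, IsTest (Ω ×ˢ Ioo (-T) T) φ → ∀ w : H10Q Ω T, IsJetOf (H10Q.jet Ω T w) φ →
    ℓ w = ∫ p in Ω ×ˢ Ioo 0 T, u p * box φ p

/-- The pairs `(u, □ũ)` with `u ∈ L²(Q)` and `□ũ ∈ [H¹₀(Q₋)]*`, with the graph norm
`(‖u‖² + ‖□ũ‖²)^{1/2}`. -/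
def HSub (Ω : Set (Pt n)) (T : ℝ) :
    Submodule ℝ (WithLp 2 (L2 (Ω ×ˢ Ioo 0 T) × StrongDual ℝ (H10Q Ω T))) where
  carrier := {z | IsBox Ω T z.fst z.snd}
  zero_mem' := by
    intro φ hφ w hw
    simp only [WithLp.zero_snd, WithLp.zero_fst, _root_.zero_apply]
    symm
    refine integral_eq_zero_of_ae ?_
    filter_upwards [Lp.coeFn_zero ℝ 2 (volume.restrict (Ω ×ˢ Ioo 0 T))] with p hp
    rw [hp]; simp
  add_mem' := by
    intro y z hy hz φ hφ w hw
    simp only [WithLp.add_snd, WithLp.add_fst, _root_.add_apply]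
    rw [hy φ hφ w hw, hz φ hφ w hw,
      ← integral_add (box_integrable hφ y.fst) (box_integrable hφ z.fst)]
    refine integral_congr_ae ?_
    filter_upwards [Lp.coeFn_add y.fst z.fst] with p hp
    rw [hp, Pi.add_apply, add_mul]
  smul_mem' := by
    intro c y hy φ hφ w hw
    simp only [WithLp.smul_snd, WithLp.smul_fst, _root_.smul_apply]
    rw [hy φ hφ w hw, ← integral_smul]
    refine integral_congr_ae ?_
    filter_upwards [Lp.coeFn_smul c y.fst] with p hp
    rw [hp, Pi.smul_apply, smul_eq_mul, smul_eq_mul, mul_assoc]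

/-- The space `𝓗(Q) = {u ∈ L²(Q) : □ũ ∈ [H¹₀(Q₋)]*}` with the graph norm; an element is carried
along with its `□ũ`, which is determined by `u`. -/
def H (Ω : Set (Pt n)) (T : ℝ) : Type := HSub Ω T

instance (Ω : Set (Pt n)) (T : ℝ) : NormedAddCommGroup (H Ω T) :=
  inferInstanceAs (NormedAddCommGroup (HSub Ω T))
instance (Ω : Set (Pt n)) (T : ℝ) : NormedSpace ℝ (H Ω T) :=
  inferInstanceAs (NormedSpace ℝ (HSub Ω T))

/-- The underlying function `u ∈ L²(Q)`. -/
def H.toL2 (Ω : Set (Pt n)) (T : ℝ) : H Ω T →L[ℝ] L2 (Ω ×ˢ Ioo 0 T) :=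
  (WithLp.fstL 2 ℝ (L2 (Ω ×ˢ Ioo 0 T)) (StrongDual ℝ (H10Q Ω T))).comp (HSub Ω T).subtypeL

/-- The map `u ↦ □ũ ∈ [H¹₀(Q₋)]*`. -/
def H.boxDual (Ω : Set (Pt n)) (T : ℝ) : H Ω T →L[ℝ] StrongDual ℝ (H10Q Ω T) :=
  (WithLp.sndL 2 ℝ (L2 (Ω ×ˢ Ioo 0 T)) (StrongDual ℝ (H10Q Ω T))).comp (HSub Ω T).subtypeL

/-- `H^{1,1}_{0;0,}(Q)` (zero lateral and zero initial values) as a subspace of `L²(Q)`. -/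
def H110 (Ω : Set (Pt n)) (T : ℝ) : Submodule ℝ (L2 (Ω ×ˢ Ioo 0 T)) :=
  (H11 Ω T 0 (Or.inl rfl)).map (WithLp.fstL 2 ℝ _ _).toLinearMap

/-- The closure of `H^{1,1}_{0;0,}(Q)` in `𝓗(Q)`. -/
def XSub (Ω : Set (Pt n)) (T : ℝ) : Submodule ℝ (H Ω T) :=
  ((H110 Ω T).comap (H.toL2 Ω T).toLinearMap).topologicalClosure

/-- The state space `X = 𝓗_{0;0,}(Q)`. -/
def X (Ω : Set (Pt n)) (T : ℝ) : Type := XSub Ω T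

instance (Ω : Set (Pt n)) (T : ℝ) : NormedAddCommGroup (X Ω T) :=
  inferInstanceAs (NormedAddCommGroup (XSub Ω T))
instance (Ω : Set (Pt n)) (T : ℝ) : NormedSpace ℝ (X Ω T) :=
  inferInstanceAs (NormedSpace ℝ (XSub Ω T))

/-- The inclusion of `X` in `𝓗(Q)`. -/
def X.toH (Ω : Set (Pt n)) (T : ℝ) : X Ω T →L[ℝ] H Ω T := (XSub Ω T).subtypeL

/-- The inclusion of `X` in `L²(Q)`. -/
def X.toL2 (Ω : Set (Pt n)) (T : ℝ) : X Ω T →L[ℝ] L2 (Ω ×ˢ Ioo 0 T) :=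
  (H.toL2 Ω T).comp (X.toH Ω T)

/-- The wave operator `B : X → Y*`, `⟨Bu, q⟩ = ⟨□ũ, 𝓔q⟩`; see `B_apply`. -/
def B (Ω : Set (Pt n)) (T : ℝ) : X Ω T →L[ℝ] StrongDual ℝ (Y Ω T) :=
  ((ContinuousLinearMap.compL ℝ (Y Ω T) (H10Q Ω T) ℝ).flip (extend Ω T)).comp
    ((H.boxDual Ω T).comp (X.toH Ω T))

theorem B_apply (Ω : Set (Pt n)) (T : ℝ) (u : X Ω T) (q : Y Ω T) :
    B Ω T u q = H.boxDual Ω T (X.toH Ω T u) (extend Ω T q) := rfl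

/-- The operator `S = B* A⁻¹ B : X → X*`, `⟨Su, v⟩ = ⟨A⁻¹Bu, Bv⟩`; see `S_apply`. -/
def S (Ω : Set (Pt n)) (T : ℝ) : X Ω T →L[ℝ] StrongDual ℝ (X Ω T) :=
  ((B Ω T).flip.comp ((A Ω T).symm : StrongDual ℝ (Y Ω T) →L[ℝ] Y Ω T)).comp (B Ω T)

theorem S_apply (Ω : Set (Pt n)) (T : ℝ) (u v : X Ω T) :
    S Ω T u v = B Ω T v ((A Ω T).symm (B Ω T u)) := rfl

/-- `‖u‖_S = ⟨Su, u⟩^{1/2}`. -/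
def normS (Ω : Set (Pt n)) (T : ℝ) (u : X Ω T) : ℝ := √(S Ω T u u)

/-- `u ∈ X` solves `ρ⟨Su, v⟩ + ⟨u, v⟩ = ⟨ū, v⟩` for all `v ∈ X`. -/
def IsSol (Ω : Set (Pt n)) (T ρ : ℝ) (ub : L2 (Ω ×ˢ Ioo 0 T)) (u : X Ω T) : Prop :=
  ∀ v : X Ω T, ρ * S Ω T u v + inner ℝ (X.toL2 Ω T u) (X.toL2 Ω T v) = inner ℝ ub (X.toL2 Ω T v)

end WaveReg
end

/-!
The variational equation is a Tikhonov problem: with `p_u = A⁻¹Bu`, one has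
`⟨Su, v⟩ = ⟨∇p_u, ∇p_v⟩`, where `∇ = (∂ₜ, ∇ₓ)` (`S_eq_inner`), so `‖u‖_S = ‖∇p_u‖`. The error
estimates then follow by testing the equation with `u` or with `u - ū` and applying Cauchy–Schwarz.

Existence needs the norm of `X` to be controlled by `‖u‖_{L²} + ‖u‖_S`, that is (`norm_boxDual_le`),
`‖□ũ‖_{[H¹₀(Q₋)]*} ≤ ‖Bu‖_{Y*}`. For a test function `φ` on `Q₋` with restriction `q` to `Q`, the
difference `φ - 𝓔q` vanishes for `t > 0` and equals the odd function `φ(x,t) - φ(x,-t)` for `t < 0`.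
As the latter is `O(|t|)`, multiplying it by smooth cut-offs in time yields test functions supported
in `t < 0` that converge to `φ - 𝓔q` in `H¹` (`mem_closure_of_negPart_oddTime`). On these `□ũ`
vanishes, since `ũ` does. Hence `⟨□ũ, φ⟩ = ⟨□ũ, 𝓔q⟩ = ⟨Bu, q⟩` with `‖q‖ ≤ ‖φ‖`, and test functions
are dense in `H¹₀(Q₋)`. In particular `𝓔q` lies in `H¹₀(Q₋)` for these `q`, so that the projection
in the definition of `extend` does nothing.

Since `X` is complete (`isClosed_HSub`), the map `u ↦ (u, √ρ ∇p_u)` embeds it as a closed subspace of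
a Hilbert space, and the solution is the preimage of the orthogonal projection of `(ū, 0)`
(`existsUnique_regularized`).
-/

namespace WaveReg
open MeasureTheory Set Filter Topology
open scoped ENNReal ContDiff Gradient InnerProductSpace

/-! ### Regularized least squares in an abstract setting -/

section Regularization
variable {V H G : Type*} [NormedAddCommGroup V] [NormedSpace ℝ V]
  [NormedAddCommGroup H] [InnerProductSpace ℝ H] [NormedAddCommGroup G] [InnerProductSpace ℝ G]

/-- `V` need not be a Hilbert space: the pair `(ι, √ρ j)` embeds it as a closed subspace of `H × G`,
and the solution is the orthogonal projection of `(f, 0)` onto that subspace. -/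
theorem existsUnique_regularized [CompleteSpace V] [CompleteSpace H] [CompleteSpace G]
    (ι : V →L[ℝ] H) (j : V →L[ℝ] G) (hb : ∀ u, ‖u‖ ^ 2 ≤ ‖ι u‖ ^ 2 + ‖j u‖ ^ 2)
    {ρ : ℝ} (hρ : 0 < ρ) (f : H) :
    ∃! u : V, ∀ v, ρ * inner ℝ (j u) (j v) + inner ℝ (ι u) (ι v) = inner ℝ f (ι v) := by
  let K : V →L[ℝ] WithLp 2 (H × G) :=
    (WithLp.prodContinuousLinearEquiv 2 ℝ H G).symm.toContinuousLinearMap.comp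
      (ι.prod (√ρ • j))
  have hK : ∀ u v, inner ℝ (K u) (K v) = inner ℝ (ι u) (ι v) + ρ * inner ℝ (j u) (j v) := by
    intro u v
    rw [WithLp.prod_inner_apply]
    change inner ℝ (ι u) (ι v) + inner ℝ (√ρ • j u) (√ρ • j v) = _
    rw [real_inner_smul_left, real_inner_smul_right, ← mul_assoc, Real.mul_self_sqrt hρ.le]
  have hKn : ∀ u, ‖K u‖ ^ 2 = ‖ι u‖ ^ 2 + ρ * ‖j u‖ ^ 2 := by
    intro u
    rw [← real_inner_self_eq_norm_sq, hK, real_inner_self_eq_norm_sq, real_inner_self_eq_norm_sq]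
  have hbd : ∀ u, ‖u‖ ^ 2 ≤ (1 + ρ⁻¹) * ‖K u‖ ^ 2 := by
    intro u
    refine (hb u).trans ?_
    rw [hKn]
    have : (1 + ρ⁻¹) * (‖ι u‖ ^ 2 + ρ * ‖j u‖ ^ 2) =
        ‖ι u‖ ^ 2 + ‖j u‖ ^ 2 + (ρ⁻¹ * ‖ι u‖ ^ 2 + ρ * ‖j u‖ ^ 2) := by
      field_simp
      ring
    rw [this]
    have : 0 ≤ ρ⁻¹ * ‖ι u‖ ^ 2 + ρ * ‖j u‖ ^ 2 := by positivity
    linarith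
  have hanti : AntilipschitzWith (Real.toNNReal √(1 + ρ⁻¹)) K := by
    refine K.antilipschitz_of_bound fun u => ?_
    rw [Real.coe_toNNReal _ (Real.sqrt_nonneg _)]
    refine le_of_sq_le_sq ?_ (by positivity)
    rw [mul_pow, Real.sq_sqrt (by positivity)]
    exact hbd u
  have hcl : IsClosed (LinearMap.range K.toLinearMap : Set (WithLp 2 (H × G))) :=
    hanti.isClosed_range K.uniformContinuous
  have : CompleteSpace (LinearMap.range K.toLinearMap) := hcl.completeSpace_coe
  let z : WithLp 2 (H × G) := WithLp.toLp 2 (f, 0)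
  obtain ⟨u, hu⟩ := (LinearMap.range K.toLinearMap).starProjection_apply_mem z
  have hz := (LinearMap.range K.toLinearMap).sub_starProjection_mem_orthogonal z
  refine ⟨u, fun v => ?_, fun w hw => ?_⟩
  · have h := (Submodule.mem_orthogonal' _ _).1 hz (K v) ⟨v, rfl⟩
    rw [← hu, inner_sub_left] at h
    have h1 : inner ℝ z (K v) = inner ℝ f (ι v) := by
      rw [WithLp.prod_inner_apply]
      change inner ℝ f (ι v) + inner ℝ (0 : G) (√ρ • j v) = _
      rw [inner_zero_left, add_zero]
    have h2 : inner ℝ (K u) (K v) = _ := hK u v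
    change inner ℝ z (K v) - inner ℝ (K u) (K v) = 0 at h
    linarith
  · have h := (Submodule.mem_orthogonal' _ _).1 hz (K (w - u)) ⟨w - u, rfl⟩
    rw [← hu, inner_sub_left] at h
    have h1 : inner ℝ z (K (w - u)) = inner ℝ f (ι (w - u)) := by
      rw [WithLp.prod_inner_apply]
      change inner ℝ f (ι (w - u)) + inner ℝ (0 : G) (√ρ • j (w - u)) = _
      rw [inner_zero_left, add_zero]
    change inner ℝ z (K (w - u)) - inner ℝ (K u) (K (w - u)) = 0 at h
    have h2 := hw (w - u)
    have h3 : ‖K (w - u)‖ ^ 2 = 0 := by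
      rw [← real_inner_self_eq_norm_sq]
      nth_rewrite 1 [map_sub]
      rw [inner_sub_left, hK w]
      linarith
    have h4 := hbd (w - u)
    rw [h3, mul_zero] at h4
    exact sub_eq_zero.1 (norm_eq_zero.1 (pow_eq_zero_iff two_ne_zero |>.1
      (le_antisymm h4 (sq_nonneg _))))

variable {ι : V →L[ℝ] H} {j : V →L[ℝ] G} {ρ : ℝ} {f : H} {u : V}

theorem regularized_norm_sub_le (hρ : 0 < ρ)
    (hu : ∀ v, ρ * inner ℝ (j u) (j v) + inner ℝ (ι u) (ι v) = inner ℝ f (ι v)) :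
    ‖ι u - f‖ ≤ ‖f‖ := by
  have h := hu u
  rw [real_inner_self_eq_norm_sq, real_inner_self_eq_norm_sq] at h
  refine le_of_sq_le_sq ?_ (norm_nonneg _)
  rw [norm_sub_sq_real, real_inner_comm]
  nlinarith [sq_nonneg ‖ι u‖, mul_nonneg hρ.le (sq_nonneg ‖j u‖)]

/-- The equation tested with `v = u - y`. -/
theorem regularized_energy {y : V}
    (hu : ∀ v, ρ * inner ℝ (j u) (j v) + inner ℝ (ι u) (ι v) = inner ℝ (ι y) (ι v)) :
    ‖ι (u - y)‖ ^ 2 + ρ * ‖j (u - y)‖ ^ 2 = - (ρ * inner ℝ (j y) (j (u - y))) := by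
  have h := hu (u - y)
  rw [← real_inner_self_eq_norm_sq, ← real_inner_self_eq_norm_sq]
  nth_rewrite 1 [map_sub ι]
  nth_rewrite 1 [map_sub j]
  rw [inner_sub_left, inner_sub_left]
  linarith

theorem regularized_energy_bounds (hρ : 0 < ρ) {y : V}
    (hu : ∀ v, ρ * inner ℝ (j u) (j v) + inner ℝ (ι u) (ι v) = inner ℝ (ι y) (ι v)) :
    ‖ι u - ι y‖ ≤ √ρ * ‖j y‖ ∧ ‖j (u - y)‖ ≤ ‖j y‖ := by
  have h := regularized_energy hu
  have hc := neg_le_of_abs_le (abs_real_inner_le_norm (j y) (j (u - y)))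
  have hc' := mul_le_mul_of_nonneg_left hc hρ.le
  have hj : ‖j (u - y)‖ ≤ ‖j y‖ := by
    by_contra! hlt
    have hpos : 0 < ‖j (u - y)‖ := (norm_nonneg _).trans_lt hlt
    have := mul_pos hρ (mul_pos hpos (sub_pos.2 hlt))
    nlinarith [sq_nonneg ‖ι (u - y)‖]
  refine ⟨?_, hj⟩
  rw [← map_sub]
  refine le_of_sq_le_sq ?_ (by positivity)
  rw [mul_pow, Real.sq_sqrt hρ.le]
  have h1 := mul_le_mul_of_nonneg_left hj (mul_nonneg hρ.le (norm_nonneg (j y)))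
  nlinarith [mul_nonneg hρ.le (sq_nonneg ‖j (u - y)‖)]

theorem regularized_source_bounds (hρ : 0 < ρ) {y : V}
    (hu : ∀ v, ρ * inner ℝ (j u) (j v) + inner ℝ (ι u) (ι v) = inner ℝ (ι y) (ι v))
    {g : H} (hg : ∀ v, inner ℝ (j y) (j v) = inner ℝ g (ι v)) :
    ‖ι u - ι y‖ ≤ ρ * ‖g‖ ∧ ‖j (u - y)‖ ≤ √ρ * ‖g‖ := by
  have h := regularized_energy hu
  rw [hg] at h
  have hc := neg_le_of_abs_le (abs_real_inner_le_norm g (ι (u - y)))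
  have hc' := mul_le_mul_of_nonneg_left hc hρ.le
  have hi : ‖ι (u - y)‖ ≤ ρ * ‖g‖ := by
    by_contra! hlt
    have hpos : 0 < ‖ι (u - y)‖ := lt_of_le_of_lt (by positivity) hlt
    have := mul_pos hpos (sub_pos.2 hlt)
    nlinarith [mul_nonneg hρ.le (sq_nonneg ‖j (u - y)‖)]
  refine ⟨by rwa [← map_sub], ?_⟩
  refine le_of_sq_le_sq ?_ (by positivity)
  rw [mul_pow, Real.sq_sqrt hρ.le]
  refine le_of_mul_le_mul_left ?_ hρ
  have h1 := mul_le_mul_of_nonneg_left hi (mul_nonneg hρ.le (norm_nonneg g))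
  nlinarith [sq_nonneg ‖ι (u - y)‖]

end Regularization

/-! ### Jets of smooth functions -/

section SmoothJets
variable {n : ℕ} {φ : Pt n × ℝ → ℝ}

theorem hasDerivAt_time (h : Differentiable ℝ φ) (p : Pt n × ℝ) :
    HasDerivAt (fun s => φ (p.1, s)) (dt φ p) p.2 := by
  have : DifferentiableAt ℝ (fun s => φ (p.1, s)) p.2 := by fun_prop
  exact this.hasDerivAt

theorem dt_eq_fderiv (h : Differentiable ℝ φ) (p : Pt n × ℝ) :
    dt φ p = fderiv ℝ φ p (0, 1) := by
  have h2 : HasDerivAt (fun s : ℝ => (p.1, s)) ((0 : Pt n), (1 : ℝ)) p.2 :=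
    (hasDerivAt_const _ _).prodMk (hasDerivAt_id _)
  exact ((h (p.1, p.2)).hasFDerivAt.comp_hasDerivAt p.2 h2).deriv

theorem gradx_eq_fderiv (h : Differentiable ℝ φ) (p : Pt n × ℝ) :
    gradx φ p = (InnerProductSpace.toDual ℝ (Pt n)).symm
      ((fderiv ℝ φ p).comp (ContinuousLinearMap.inl ℝ (Pt n) ℝ)) := by
  unfold gradx gradient
  congr 1
  exact ((h (p.1, p.2)).hasFDerivAt.comp p.1 (hasFDerivAt_prodMk_left p.1 p.2)).fderiv

theorem continuous_dt (h : ContDiff ℝ ∞ φ) : Continuous (dt φ) := by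
  have : dt φ = fun p => fderiv ℝ φ p (0, 1) :=
    funext (dt_eq_fderiv (h.differentiable (by simp)))
  rw [this]
  exact (h.continuous_fderiv (by simp)).clm_apply continuous_const

theorem continuous_gradx (h : ContDiff ℝ ∞ φ) : Continuous (gradx φ) := by
  have : gradx φ = fun p => (InnerProductSpace.toDual ℝ (Pt n)).symm
      ((fderiv ℝ φ p).comp (ContinuousLinearMap.inl ℝ (Pt n) ℝ)) :=
    funext (gradx_eq_fderiv (h.differentiable (by simp)))
  rw [this]
  exact (LinearIsometryEquiv.continuous _).comp
    ((h.continuous_fderiv (by simp)).clm_comp continuous_const)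

theorem hasCompactSupport_dt (h : ContDiff ℝ ∞ φ) (hc : HasCompactSupport φ) :
    HasCompactSupport (dt φ) := by
  refine (hc.fderiv (𝕜 := ℝ)).mono fun p hp h0 => hp ?_
  rw [dt_eq_fderiv (h.differentiable (by simp)), h0]
  rfl

theorem hasCompactSupport_gradx (h : ContDiff ℝ ∞ φ) (hc : HasCompactSupport φ) :
    HasCompactSupport (gradx φ) := by
  refine (hc.fderiv (𝕜 := ℝ)).mono fun p hp h0 => hp ?_
  rw [gradx_eq_fderiv (h.differentiable (by simp)), h0]
  simp

theorem exists_isJetOf (D : Set (Pt n × ℝ)) (h : ContDiff ℝ ∞ φ) (hc : HasCompactSupport φ) :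
    ∃ w : Jet D, IsJetOf w φ := by
  have m1 : MemLp φ 2 (volume.restrict D) :=
    (h.continuous.memLp_of_hasCompactSupport hc (μ := volume)).restrict D
  have m2 : MemLp (dt φ) 2 (volume.restrict D) :=
    ((continuous_dt h).memLp_of_hasCompactSupport (hasCompactSupport_dt h hc)
      (μ := volume)).restrict D
  have m3 : MemLp (gradx φ) 2 (volume.restrict D) :=
    ((continuous_gradx h).memLp_of_hasCompactSupport (hasCompactSupport_gradx h hc)
      (μ := volume)).restrict D
  exact ⟨WithLp.toLp 2 (m1.toLp, WithLp.toLp 2 (m2.toLp, m3.toLp)),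
    m1.coeFn_toLp, m2.coeFn_toLp, m3.coeFn_toLp⟩

/-- Dominated convergence in `L²`, with a constant bound on a finite measure space. -/
theorem tendsto_Lp_of_bounded {α F : Type*} [MeasurableSpace α] [NormedAddCommGroup F]
    {μ : Measure α} [IsFiniteMeasure μ] {f : ℕ → Lp F 2 μ} {f₀ : Lp F 2 μ} {g : ℕ → α → F}
    {g₀ : α → F} (hf : ∀ k, f k =ᵐ[μ] g k) (hf₀ : f₀ =ᵐ[μ] g₀) {C : ℝ}
    (hC : ∀ k x, ‖g k x‖ ≤ C) (hlim : ∀ x, Tendsto (fun k => g k x) atTop (𝓝 (g₀ x))) :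
    Tendsto f atTop (𝓝 f₀) := by
  have hf' := ae_all_iff.2 hf
  have hs := ae_all_iff.2 fun k => Lp.coeFn_sub (f k) f₀
  have key : Tendsto (fun k => ∫⁻ x, ‖(f k - f₀) x‖ₑ ^ 2 ∂μ) atTop (𝓝 (∫⁻ _, 0 ∂μ)) := by
    refine tendsto_lintegral_of_dominated_convergence (fun _ => ENNReal.ofReal (2 * C) ^ 2)
      (fun k => (Lp.stronglyMeasurable _).enorm.pow_const 2) (fun k => ?_) ?_ ?_
    · filter_upwards [hf', hs, hf₀] with x h1 h2 h3
      rw [h2, Pi.sub_apply, h1, h3, ← ofReal_norm]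
      gcongr
      have : ‖g₀ x‖ ≤ C := le_of_tendsto' (hlim x).norm fun k => hC k x
      refine (norm_sub_le _ _).trans ?_
      linarith [hC k x]
    · rw [lintegral_const]
      finiteness
    · filter_upwards [hf', hs, hf₀] with x h1 h2 h3
      have : Tendsto (fun k => g k x - g₀ x) atTop (𝓝 (g₀ x - g₀ x)) :=
        (hlim x).sub tendsto_const_nhds
      have := (this.enorm).ennrpow_const 2
      simp only [sub_self, enorm_zero] at this
      refine (tendsto_congr fun k => ?_).1 (by simpa using this)
      rw [h2, Pi.sub_apply, h1, h3]
  simp only [Lp_lint_sq, lintegral_zero] at key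
  rw [tendsto_iff_edist_tendsto_0]
  simp only [edist_eq_enorm_sub]
  have := key.ennrpow_const (1 / 2)
  rw [ENNReal.zero_rpow_of_pos (by norm_num)] at this
  refine this.congr fun k => ?_
  rw [← ENNReal.rpow_natCast, ← ENNReal.rpow_mul]
  norm_num

theorem tendsto_jet {D : Set (Pt n × ℝ)} {v : ℕ → Jet D} {w : Jet D}
    (h1 : Tendsto (fun k => (v k).fst) atTop (𝓝 w.fst))
    (h2 : Tendsto (fun k => (v k).snd.fst) atTop (𝓝 w.snd.fst))
    (h3 : Tendsto (fun k => (v k).snd.snd) atTop (𝓝 w.snd.snd)) : Tendsto v atTop (𝓝 w) := by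
  have h4 : Tendsto (fun k => (v k).snd) atTop (𝓝 w.snd) :=
    ((WithLp.prodContinuousLinearEquiv 2 ℝ (L2 D) (L2vec D)).symm.continuous.tendsto _).comp
      (h2.prodMk_nhds h3)
  exact ((WithLp.prodContinuousLinearEquiv 2 ℝ (L2 D)
    (WithLp 2 (L2 D × L2vec D))).symm.continuous.tendsto _).comp (h1.prodMk_nhds h4)

end SmoothJets

/-! ### The odd part of a test function, cut off at negative times -/

section Reflection
variable {n : ℕ}

/-- A smooth cut-off in time: `1` for `t ≤ -2/(k+1)` and `0` for `t ≥ -1/(k+1)`. -/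
noncomputable def timeCutoff (k : ℕ) (t : ℝ) : ℝ := Real.smoothTransition (-((k + 1) * t) - 1)

theorem contDiff_timeCutoff (k : ℕ) : ContDiff ℝ ∞ (timeCutoff k) := by
  unfold timeCutoff
  exact Real.smoothTransition.contDiff.comp (by fun_prop)

theorem timeCutoff_eq_zero {k : ℕ} {t : ℝ} (h : -1 / ((k : ℝ) + 1) ≤ t) : timeCutoff k t = 0 := by
  have hk : (0 : ℝ) < k + 1 := by positivity
  rw [div_le_iff₀ hk] at h
  exact Real.smoothTransition.zero_of_nonpos (by linarith)

theorem abs_timeCutoff_le (k : ℕ) (t : ℝ) : |timeCutoff k t| ≤ 1 := by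
  rw [timeCutoff, abs_of_nonneg (Real.smoothTransition.nonneg _)]
  exact Real.smoothTransition.le_one _

theorem deriv_timeCutoff (k : ℕ) (t : ℝ) : deriv (timeCutoff k) t =
    -(k + 1) * deriv Real.smoothTransition (-((k + 1) * t) - 1) := by
  have h1 : HasDerivAt (fun t : ℝ => -(((k : ℝ) + 1) * t) - 1) (-(k + 1)) t := by
    simpa using (((hasDerivAt_id t).const_mul ((k : ℝ) + 1)).neg.sub_const 1)
  have h2 : HasDerivAt Real.smoothTransition _ (-(((k : ℝ) + 1) * t) - 1) :=
    ((Real.smoothTransition.contDiff (n := 1)).differentiable (by simp) _).hasDerivAt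
  have := (h2.comp t h1).deriv
  rw [mul_comm]
  exact this

theorem timeCutoff_eventually (t : ℝ) : ∀ᶠ k : ℕ in atTop,
    timeCutoff k t = (if t < 0 then 1 else 0) ∧ deriv (timeCutoff k) t = 0 := by
  rcases lt_or_ge t 0 with h | h
  · have hl : Tendsto (fun k : ℕ => ((k : ℝ) + 1) * -t) atTop atTop :=
      (tendsto_atTop_add_const_right _ _ tendsto_natCast_atTop_atTop).atTop_mul_const (by linarith)
    filter_upwards [hl.eventually_gt_atTop 2] with k hk
    have hs : 1 < -((k + 1) * t) - 1 := by linarith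
    rw [if_pos h, deriv_timeCutoff]
    refine ⟨Real.smoothTransition.one_of_one_le hs.le, ?_⟩
    have : Real.smoothTransition =ᶠ[𝓝 (-((k + 1) * t) - 1)] fun _ => 1 := by
      filter_upwards [lt_mem_nhds hs] with s hs
      exact Real.smoothTransition.one_of_one_le hs.le
    rw [this.deriv_eq, deriv_const, mul_zero]
  · refine Eventually.of_forall fun k => ?_
    have hk : (0 : ℝ) ≤ (k + 1) * t := by positivity
    have hs : -((k + 1) * t) - 1 < 0 := by linarith
    rw [if_neg h.not_gt, deriv_timeCutoff]
    refine ⟨Real.smoothTransition.zero_of_nonpos hs.le, ?_⟩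
    have : Real.smoothTransition =ᶠ[𝓝 (-((k + 1) * t) - 1)] fun _ => 0 := by
      filter_upwards [gt_mem_nhds hs] with s hs
      exact Real.smoothTransition.zero_of_nonpos hs.le
    rw [this.deriv_eq, deriv_const, mul_zero]

theorem deriv_smoothTransition_eq_zero {s : ℝ} (hs : s ∉ Icc (0 : ℝ) 1) :
    deriv Real.smoothTransition s = 0 := by
  rw [mem_Icc, not_and_or, not_le, not_le] at hs
  rcases hs with hs | hs
  · have : Real.smoothTransition =ᶠ[𝓝 s] fun _ => 0 := by
      filter_upwards [gt_mem_nhds hs] with s hs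
      exact Real.smoothTransition.zero_of_nonpos hs.le
    rw [this.deriv_eq, deriv_const]
  · have : Real.smoothTransition =ᶠ[𝓝 s] fun _ => 1 := by
      filter_upwards [lt_mem_nhds hs] with s hs
      exact Real.smoothTransition.one_of_one_le hs.le
    rw [this.deriv_eq, deriv_const]

/-- The derivative of the cut-off is of size `1/|t|`, uniformly in `k`. -/
theorem exists_abs_mul_deriv_timeCutoff_le :
    ∃ C : ℝ, ∀ (k : ℕ) (t : ℝ), |t| * |deriv (timeCutoff k) t| ≤ C := by
  have hc : Continuous fun s : ℝ => (s + 1) * deriv Real.smoothTransition s :=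
    (by fun_prop : Continuous fun s : ℝ => s + 1).mul
      ((Real.smoothTransition.contDiff (n := 1)).continuous_deriv (by simp))
  have hs : HasCompactSupport fun s : ℝ => (s + 1) * deriv Real.smoothTransition s :=
    HasCompactSupport.intro isCompact_Icc fun s hs => by
      rw [deriv_smoothTransition_eq_zero hs, mul_zero]
  obtain ⟨C, hC⟩ := hs.exists_bound_of_continuous hc
  refine ⟨C, fun k t => ?_⟩
  rw [← abs_mul, deriv_timeCutoff]
  convert hC (-((k + 1) * t) - 1) using 1
  rw [Real.norm_eq_abs]
  congr 1
  ring

variable {φ : Pt n × ℝ → ℝ}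

/-- Twice the odd part of `φ` in time. -/
def oddTime (φ : Pt n × ℝ → ℝ) (p : Pt n × ℝ) : ℝ := φ p - φ (p.1, -p.2)

theorem contDiff_oddTime (h : ContDiff ℝ ∞ φ) : ContDiff ℝ ∞ (oddTime φ) := by
  unfold oddTime
  fun_prop

theorem dt_cutoff_mul_oddTime (h : Differentiable ℝ φ) {χ : ℝ → ℝ} (hχ : Differentiable ℝ χ)
    (p : Pt n × ℝ) : dt (fun p => χ p.2 * oddTime φ p) p =
      deriv χ p.2 * oddTime φ p + χ p.2 * (dt φ p + dt φ (p.1, -p.2)) := by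
  have h1 := hasDerivAt_time h p
  have h2 := (hasDerivAt_time h (p.1, -p.2)).scomp p.2 (hasDerivAt_neg p.2)
  have h3 := (hχ p.2).hasDerivAt.mul (h1.sub h2)
  refine h3.deriv.trans ?_
  rw [neg_one_smul, sub_neg_eq_add]
  rfl

theorem gradx_cutoff_mul_oddTime (h : Differentiable ℝ φ) (χ : ℝ → ℝ)
    (p : Pt n × ℝ) : gradx (fun p => χ p.2 * oddTime φ p) p =
      χ p.2 • (gradx φ p - gradx φ (p.1, -p.2)) := by
  unfold gradx oddTime
  have d1 : Differentiable ℝ fun y : Pt n => φ (y, p.2) := by fun_prop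
  have d2 : Differentiable ℝ fun y : Pt n => φ (y, -p.2) := by fun_prop
  refine (grad_smul' (χ p.2) (d1.sub d2) p.1).trans ?_
  congr 1
  simp [gradient, fderiv_sub (d1 _) (d2 _)]

theorem isTest_cutoff_mul_oddTime {Ω : Set (Pt n)} {T : ℝ}
    (hφ : IsTest (Ω ×ˢ Ioo (-T) T) φ) (k : ℕ) :
    IsTest (Ω ×ˢ Ioo (-T) 0) fun p => timeCutoff k p.2 * oddTime φ p := by
  have hr : Continuous fun p : Pt n × ℝ => (p.1, -p.2) := by fun_prop
  let e : Pt n × ℝ ≃ₜ Pt n × ℝ := (Homeomorph.refl _).prodCongr (Homeomorph.neg ℝ)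
  have hodd : HasCompactSupport (oddTime φ) :=
    hφ.2.1.sub (hφ.2.1.comp_homeomorph e)
  refine ⟨?_, hodd.mul_left, fun p hp => ?_⟩
  · exact ((contDiff_timeCutoff k).comp contDiff_snd).mul (contDiff_oddTime hφ.1)
  · have hp1 : p ∈ tsupport (oddTime φ) := tsupport_mul_subset_right hp
    have hp2 : p.2 ≤ -1 / ((k : ℝ) + 1) := by
      have hcl : IsClosed {q : Pt n × ℝ | q.2 ≤ -1 / ((k : ℝ) + 1)} :=
        isClosed_le continuous_snd continuous_const
      refine closure_minimal (fun q hq => ?_) hcl hp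
      by_contra hlt
      exact hq (by
        change timeCutoff k q.2 * oddTime φ q = 0
        rw [timeCutoff_eq_zero (not_le.1 hlt).le, zero_mul])
    have hneg : -1 / ((k : ℝ) + 1) < 0 := div_neg_of_neg_of_pos (by norm_num) (by positivity)
    have hp3 : p ∈ Ω ×ˢ Ioo (-T) T := by
      rcases tsupport_sub φ (fun p => φ (p.1, -p.2)) hp1 with h | h
      · exact hφ.2.2 h
      · have := hφ.2.2 (tsupport_comp_subset_preimage φ hr h)
        exact ⟨this.1, by linarith [this.2.2], by linarith [this.2.1]⟩
    exact ⟨hp3.1, hp3.2.1, hp2.trans_lt hneg⟩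

/-- The part of `oddTime φ` at negative times, extended by zero to positive times, is a limit in
`H¹` of test functions supported at negative times: `oddTime φ` is `O(|t|)`, so the time derivatives
of its products with `timeCutoff k` stay bounded, and dominated convergence applies. -/
theorem mem_closure_of_negPart_oddTime {Ω : Set (Pt n)} {T : ℝ}
    (hfin : IsFiniteMeasure (volume.restrict (Ω ×ˢ Ioo (-T) T) : Measure (Pt n × ℝ)))
    (hφ : IsTest (Ω ×ˢ Ioo (-T) T) φ) {w : Jet (Ω ×ˢ Ioo (-T) T)}
    (h1 : w.fst =ᵐ[volume.restrict (Ω ×ˢ Ioo (-T) T)] fun p =>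
      if p.2 < 0 then φ p - φ (p.1, -p.2) else 0)
    (h2 : w.snd.fst =ᵐ[volume.restrict (Ω ×ˢ Ioo (-T) T)] fun p =>
      if p.2 < 0 then dt φ p + dt φ (p.1, -p.2) else 0)
    (h3 : w.snd.snd =ᵐ[volume.restrict (Ω ×ˢ Ioo (-T) T)] fun p =>
      if p.2 < 0 then gradx φ p - gradx φ (p.1, -p.2) else 0) :
    w ∈ closure {v : Jet (Ω ×ˢ Ioo (-T) T) | ∃ ψ, IsTest (Ω ×ˢ Ioo (-T) 0) ψ ∧ IsJetOf v ψ} := by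
  have dφ := hφ.1.differentiable (by simp)
  have ht (k : ℕ) := isTest_cutoff_mul_oddTime hφ k
  choose v hv using fun k => exists_isJetOf (Ω ×ˢ Ioo (-T) T) (ht k).1 (ht k).2.1
  refine mem_closure_of_tendsto (f := v) (b := atTop) ?_
    (Eventually.of_forall fun k => ⟨_, ht k, hv k⟩)
  obtain ⟨C₁, hC₁⟩ := hφ.2.1.exists_bound_of_continuous hφ.1.continuous
  obtain ⟨C₂, hC₂⟩ := (hasCompactSupport_dt hφ.1 hφ.2.1).exists_bound_of_continuous
    (continuous_dt hφ.1)
  obtain ⟨C₃, hC₃⟩ := (hasCompactSupport_gradx hφ.1 hφ.2.1).exists_bound_of_continuous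
    (continuous_gradx hφ.1)
  obtain ⟨L, hL⟩ := hφ.1.lipschitzWith_of_hasCompactSupport hφ.2.1 (by simp)
  obtain ⟨C₄, hC₄⟩ := exists_abs_mul_deriv_timeCutoff_le
  have hodd : ∀ p : Pt n × ℝ, |oddTime φ p| ≤ 2 * L * |p.2| := by
    intro p
    have := hL.dist_le_mul p (p.1, -p.2)
    rw [Real.dist_eq, Prod.dist_eq, dist_self, max_eq_right dist_nonneg, Real.dist_eq,
      sub_neg_eq_add, ← two_mul, abs_mul, abs_two] at this
    exact this.trans_eq (by ring)
  have hdχ (k : ℕ) : Differentiable ℝ (timeCutoff k) :=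
    (contDiff_timeCutoff k).differentiable (by simp)
  have hL0 : (0 : ℝ) ≤ L := L.2
  refine tendsto_jet ?_ ?_ ?_
  · refine tendsto_Lp_of_bounded (fun k => (hv k).1) h1 (C := C₁ + C₁) (fun k p => ?_)
      fun p => ?_
    · rw [norm_mul, Real.norm_eq_abs (timeCutoff _ _)]
      refine (mul_le_of_le_one_left (norm_nonneg _) (abs_timeCutoff_le _ _)).trans ?_
      exact (norm_sub_le _ _).trans (add_le_add (hC₁ _) (hC₁ _))
    · refine tendsto_const_nhds.congr' ?_
      filter_upwards [timeCutoff_eventually p.2] with k hk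
      rw [hk.1, oddTime, ite_mul, one_mul, zero_mul]
  · refine tendsto_Lp_of_bounded (fun k => (hv k).2.1) h2 (C := 2 * L * C₄ + (C₂ + C₂))
      (fun k p => ?_) fun p => ?_
    · rw [dt_cutoff_mul_oddTime dφ (hdχ k)]
      refine (norm_add_le _ _).trans (add_le_add ?_ ?_)
      · rw [norm_mul, Real.norm_eq_abs, Real.norm_eq_abs, mul_comm]
        calc _ ≤ 2 * L * |p.2| * |deriv (timeCutoff k) p.2| := by gcongr; exact hodd p
          _ = 2 * L * (|p.2| * |deriv (timeCutoff k) p.2|) := by ring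
          _ ≤ _ := by gcongr; exact hC₄ k p.2
      · rw [norm_mul, Real.norm_eq_abs (timeCutoff _ _)]
        refine (mul_le_of_le_one_left (norm_nonneg _) (abs_timeCutoff_le _ _)).trans ?_
        exact (norm_add_le _ _).trans (add_le_add (hC₂ _) (hC₂ _))
    · refine tendsto_const_nhds.congr' ?_
      filter_upwards [timeCutoff_eventually p.2] with k hk
      rw [dt_cutoff_mul_oddTime dφ (hdχ k), hk.1, hk.2, zero_mul, zero_add, ite_mul, one_mul,
        zero_mul]
  · refine tendsto_Lp_of_bounded (fun k => (hv k).2.2) h3 (C := C₃ + C₃) (fun k p => ?_)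
      fun p => ?_
    · rw [gradx_cutoff_mul_oddTime dφ, norm_smul, Real.norm_eq_abs]
      refine (mul_le_of_le_one_left (norm_nonneg _) (abs_timeCutoff_le _ _)).trans ?_
      exact (norm_sub_le _ _).trans (add_le_add (hC₃ _) (hC₃ _))
    · refine tendsto_const_nhds.congr' ?_
      filter_upwards [timeCutoff_eventually p.2] with k hk
      rw [gradx_cutoff_mul_oddTime dφ, hk.1, ite_smul, one_smul, zero_smul]

end Reflection

/-! ### Completeness of the state space -/

section Complete
variable {n : ℕ} (Ω : Set (Pt n)) (T : ℝ)

theorem continuous_integral_mul_box {D D' : Set (Pt n × ℝ)} {φ : Pt n × ℝ → ℝ}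
    (hφ : IsTest D' φ) : Continuous fun u : L2 D => ∫ p in D, u p * box φ p := by
  have hb : MemLp (box φ) 2 (volume.restrict D) := by
    have c : Continuous (iteratedFDeriv ℝ 2 φ) :=
      (contDiff_infty.1 hφ.1 2).continuous_iteratedFDeriv'
    have cb : Continuous (box φ) := by unfold box; fun_prop
    have cs : HasCompactSupport (box φ) := by
      refine (hφ.2.1.iteratedFDeriv (𝕜 := ℝ) 2).mono fun p hp h0 => hp ?_
      unfold box
      rw [h0]
      simp
    exact (cb.memLp_of_hasCompactSupport cs (p := 2) (μ := volume)).restrict D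
  have : (fun u : L2 D => ∫ p in D, u p * box φ p) = fun u => inner ℝ hb.toLp u := by
    funext u
    rw [L2.inner_def]
    refine integral_congr_ae ?_
    filter_upwards [hb.coeFn_toLp] with p hp
    rw [hp]
    rfl
  rw [this]
  fun_prop

theorem isClosed_HSub :
    IsClosed (HSub Ω T : Set (WithLp 2 (L2 (Ω ×ˢ Ioo 0 T) × StrongDual ℝ (H10Q Ω T)))) := by
  have : (HSub Ω T : Set (WithLp 2 (L2 (Ω ×ˢ Ioo 0 T) × StrongDual ℝ (H10Q Ω T)))) =
      ⋂ (φ : Pt n × ℝ → ℝ) (_ : IsTest (Ω ×ˢ Ioo (-T) T) φ) (w : H10Q Ω T)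
        (_ : IsJetOf (H10Q.jet Ω T w) φ),
        {z | z.snd w = ∫ p in Ω ×ˢ Ioo 0 T, z.fst p * box φ p} := by
    ext z
    simp only [mem_iInter]
    rfl
  rw [this]
  refine isClosed_iInter fun φ => isClosed_iInter fun hφ => isClosed_iInter fun w =>
    isClosed_iInter fun _ => isClosed_eq ?_ ?_
  · exact (ContinuousLinearMap.apply ℝ ℝ w).continuous.comp (WithLp.sndL 2 ℝ _ _).continuous
  · exact (continuous_integral_mul_box hφ).comp (WithLp.fstL 2 ℝ _ _).continuous

instance : CompleteSpace (H Ω T) := (isClosed_HSub Ω T).completeSpace_coe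

instance : CompleteSpace (X Ω T) :=
  inferInstanceAs (CompleteSpace (Submodule.topologicalClosure _ : Submodule ℝ (H Ω T)))

end Complete

/-! ### The dual norm of `□ũ` and the norm of `Bu` -/

section Bound
variable {n : ℕ} {Ω : Set (Pt n)} {T : ℝ}

theorem proj_jet (w : H10Q Ω T) : H10Q.proj Ω T (H10Q.jet Ω T w) = w :=
  Submodule.orthogonalProjectionOnto_mem_subspace_eq_self (K := H10st (Ω ×ˢ Ioo (-T) T)) w

theorem jet_proj {v : Jet (Ω ×ˢ Ioo (-T) T)} (hv : v ∈ H10st (Ω ×ˢ Ioo (-T) T)) :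
    H10Q.jet Ω T (H10Q.proj Ω T v) = v :=
  congrArg Subtype.val (Submodule.orthogonalProjectionOnto_mem_subspace_eq_self
    (K := H10st (Ω ×ˢ Ioo (-T) T)) ⟨v, hv⟩)

theorem IsTest.mono {F : Type*} [NormedAddCommGroup F] [NormedSpace ℝ F] {D D' : Set F}
    {φ : F → ℝ} (h : IsTest D φ) (hD : D ⊆ D') : IsTest D' φ :=
  ⟨h.1, h.2.1, h.2.2.trans hD⟩

theorem box_eq_zero {φ : Pt n × ℝ → ℝ} {p : Pt n × ℝ} (hp : p ∉ tsupport φ) : box φ p = 0 := by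
  have : iteratedFDeriv ℝ 2 φ p = 0 := by
    by_contra h
    exact hp (support_iteratedFDeriv_subset (𝕜 := ℝ) 2 h)
  unfold box
  rw [this]
  simp

theorem negTime_subset (Ω : Set (Pt n)) (T : ℝ) : Ω ×ˢ Ioo (-T) 0 ⊆ Ω ×ˢ Ioo (-T) T := by
  rintro p ⟨h1, h2, h3⟩
  exact ⟨h1, h2, by linarith⟩

/-- As `ũ` vanishes for `t < 0`, so does the functional `□ũ` on limits of test functions supported
there. -/
theorem IsBox.eq_zero_of_mem_closure {u : L2 (Ω ×ˢ Ioo 0 T)} {ℓ : StrongDual ℝ (H10Q Ω T)}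
    (hℓ : IsBox Ω T u ℓ) {w : H10Q Ω T}
    (hw : H10Q.jet Ω T w ∈
      closure {v : Jet (Ω ×ˢ Ioo (-T) T) | ∃ ψ, IsTest (Ω ×ˢ Ioo (-T) 0) ψ ∧ IsJetOf v ψ}) :
    ℓ w = 0 := by
  have hcl : IsClosed {v : Jet (Ω ×ˢ Ioo (-T) T) | ℓ (H10Q.proj Ω T v) = 0} :=
    isClosed_eq (ℓ.continuous.comp (H10Q.proj Ω T).continuous) continuous_const
  have := closure_minimal ?_ hcl hw
  · rw [mem_ofPred_eq, proj_jet] at this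
    exact this
  · rintro v ⟨ψ, hψ, hv⟩
    have hψ' := hψ.mono (negTime_subset Ω T)
    have hmem : v ∈ H10st (Ω ×ˢ Ioo (-T) T) := Submodule.le_topologicalClosure _ ⟨ψ, hψ', hv⟩
    rw [mem_ofPred_eq, hℓ ψ hψ' _ (by rwa [jet_proj hmem])]
    refine setIntegral_eq_zero_of_forall_eq_zero fun p hp => ?_
    rw [box_eq_zero fun h => lt_asymm hp.2.1 (hψ.2.2 h).2.2, mul_zero]

theorem exists_graph_of_isTest {φ : Pt n → ℝ} (h : IsTest Ω φ) :
    ∃ z ∈ H10 Ω, z.fst =ᵐ[volume.restrict Ω] φ ∧ z.snd =ᵐ[volume.restrict Ω] ∇ φ := by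
  have hg : (∇ φ) = fun x => (InnerProductSpace.toDual ℝ (Pt n)).symm (fderiv ℝ φ x) := rfl
  have c : Continuous (∇ φ) := by
    rw [hg]
    exact (LinearIsometryEquiv.continuous _).comp (h.1.continuous_fderiv (by simp))
  have cs : HasCompactSupport (∇ φ) := by
    refine (h.2.1.fderiv (𝕜 := ℝ)).mono fun p hp h0 => hp ?_
    rw [hg]
    simp [h0]
  have m1 : MemLp φ 2 (volume.restrict Ω) :=
    (h.1.continuous.memLp_of_hasCompactSupport h.2.1 (μ := volume)).restrict Ω
  have m2 : MemLp (∇ φ) 2 (volume.restrict Ω) :=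
    (c.memLp_of_hasCompactSupport cs (μ := volume)).restrict Ω
  exact ⟨WithLp.toLp 2 (m1.toLp, m2.toLp), Submodule.le_topologicalClosure _
    ⟨φ, h, m1.coeFn_toLp, m2.coeFn_toLp⟩, m1.coeFn_toLp, m2.coeFn_toLp⟩

theorem IsTest.slice {D : Set ℝ} {φ : Pt n × ℝ → ℝ} (h : IsTest (Ω ×ˢ D) φ) (t : ℝ) :
    IsTest Ω fun x => φ (x, t) := by
  have hi : Topology.IsClosedEmbedding fun x : Pt n => (x, t) := by
    refine IsClosedEmbedding.of_continuous_injective_isClosedMap (by fun_prop)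
      (fun a b hab => congrArg Prod.fst hab) fun s hs => ?_
    have : (fun x : Pt n => (x, t)) '' s = s ×ˢ {t} := by simp [prod_singleton]
    rw [this]
    exact hs.prod isClosed_singleton
  refine ⟨by have := h.1; fun_prop, h.2.1.comp_isClosedEmbedding hi, fun x hx => ?_⟩
  exact (h.2.2 (tsupport_comp_subset_preimage φ hi.continuous hx)).1

/-- The restriction to `Q` of a test function on `Q₋` is in `Y`. -/
theorem mem_H11_of_isTest {φ : Pt n × ℝ → ℝ} (h : IsTest (Ω ×ˢ Ioo (-T) T) φ)
    {v : Jet (Ω ×ˢ Ioo 0 T)} (hv : IsJetOf v φ) : v ∈ H11 Ω T T (Or.inr rfl) := by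
  have e := res_cyl Ω 0 T
  constructor
  · filter_upwards [ae_swap e hv.1, ae_swap e hv.2.2] with t h1 h2
    obtain ⟨z, hz, z1, z2⟩ := exists_graph_of_isTest (h.slice t)
    refine ⟨z, hz, ?_, ?_⟩
    · filter_upwards [z1, h1] with x a b
      rw [a, b]
    · filter_upwards [z2, h2] with x a b
      rw [a, b]
      rfl
  · filter_upwards [hv.1, ae_fst e hv.2.1, ae_time Ω 0 T] with p h1 h2 h3
    rw [h1, volt_congr (Or.inr rfl) h3 h2, intervalIntegral.integral_eq_sub_of_hasDerivAt
      (f := fun s => φ (p.1, s))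
      (fun s _ => hasDerivAt_time (h.1.differentiable (by simp)) (p.1, s))]
    · have : φ (p.1, T) = 0 := by
        by_contra h0
        exact lt_irrefl _ (h.2.2 (subset_tsupport _ h0)).2.2
      simp [this]
    · have hc : Continuous fun s : ℝ => (p.1, s) := by fun_prop
      exact ((continuous_dt h.1).comp hc).intervalIntegrable _ _

theorem norm_le_of_ae_eq {F : Type*} [NormedAddCommGroup F] {D D' : Set (Pt n × ℝ)} (hD : D ⊆ D')
    {f : Lp F 2 (volume.restrict D)} {g : Lp F 2 (volume.restrict D')} {φ : Pt n × ℝ → F}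
    (hf : f =ᵐ[volume.restrict D] φ) (hg : g =ᵐ[volume.restrict D'] φ) : ‖f‖ ≤ ‖g‖ := by
  rw [Lp.norm_def, Lp.norm_def, eLpNorm_congr_ae hf, eLpNorm_congr_ae hg]
  refine ENNReal.toReal_mono ?_ (eLpNorm_mono_measure _ (Measure.restrict_mono hD le_rfl))
  rw [← eLpNorm_congr_ae hg]
  exact Lp.eLpNorm_ne_top g

theorem IsJetOf.norm_le {D D' : Set (Pt n × ℝ)} (hD : D ⊆ D') {v : Jet D} {w : Jet D'}
    {φ : Pt n × ℝ → ℝ} (hv : IsJetOf v φ) (hw : IsJetOf w φ) : ‖v‖ ≤ ‖w‖ := by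
  refine le_of_sq_le_sq ?_ (norm_nonneg _)
  rw [WithLp.prod_norm_sq_eq_of_L2 v, WithLp.prod_norm_sq_eq_of_L2 w,
    WithLp.prod_norm_sq_eq_of_L2 v.snd, WithLp.prod_norm_sq_eq_of_L2 w.snd]
  have h1 := norm_le_of_ae_eq hD hv.1 hw.1
  have h2 := norm_le_of_ae_eq hD hv.2.1 hw.2.1
  have h3 := norm_le_of_ae_eq hD hv.2.2 hw.2.2
  gcongr

/-- A test function on `Q₋` minus the even reflection of its restriction to `Q` is a limit in `H¹` of
test functions supported at negative times. -/
theorem sub_reflJet_mem_closure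
    (hfin : IsFiniteMeasure (volume.restrict (Ω ×ˢ Ioo (-T) T) : Measure (Pt n × ℝ)))
    {φ : Pt n × ℝ → ℝ} (hφ : IsTest (Ω ×ˢ Ioo (-T) T) φ) {w : Jet (Ω ×ˢ Ioo (-T) T)}
    (hw : IsJetOf w φ) {v : Jet (Ω ×ˢ Ioo 0 T)} (hv : IsJetOf v φ) :
    w - reflJet Ω T v ∈
      closure {v : Jet (Ω ×ˢ Ioo (-T) T) | ∃ ψ, IsTest (Ω ×ˢ Ioo (-T) 0) ψ ∧ IsJetOf v ψ} := by
  refine mem_closure_of_negPart_oddTime hfin hφ ?_ ?_ ?_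
  · filter_upwards [Lp.coeFn_sub w.fst (reflJet Ω T v).fst, hw.1,
      reflLp_ae Ω T 1 (by simp) v.fst, reflFun_ae Ω T hv.1] with p h1 h2 h3 h4
    change (w.fst - (reflJet Ω T v).fst) p = _
    rw [h1, Pi.sub_apply, h2, (reflJet_apply Ω T v).1, h3, reflFun, h4]
    split_ifs with h
    · rw [abs_of_neg h, one_smul]
    · rw [abs_of_nonneg (not_lt.1 h), one_smul, sub_self]
  · filter_upwards [Lp.coeFn_sub w.snd.fst (reflJet Ω T v).snd.fst, hw.2.1,
      reflLp_ae Ω T (-1) (by simp) v.snd.fst, reflFun_ae Ω T hv.2.1] with p h1 h2 h3 h4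
    change (w.snd.fst - (reflJet Ω T v).snd.fst) p = _
    rw [h1, Pi.sub_apply, h2, (reflJet_apply Ω T v).2.1, h3, reflFun, h4]
    split_ifs with h
    · rw [abs_of_neg h, neg_one_smul, sub_neg_eq_add]
    · rw [abs_of_nonneg (not_lt.1 h), one_smul, sub_self]
  · filter_upwards [Lp.coeFn_sub w.snd.snd (reflJet Ω T v).snd.snd, hw.2.2,
      reflLp_ae Ω T 1 (by simp) v.snd.snd, reflFun_ae Ω T hv.2.2] with p h1 h2 h3 h4
    change (w.snd.snd - (reflJet Ω T v).snd.snd) p = _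
    rw [h1, Pi.sub_apply, h2, (reflJet_apply Ω T v).2.2, h3, reflFun, h4]
    split_ifs with h
    · rw [abs_of_neg h, one_smul]
    · rw [abs_of_nonneg (not_lt.1 h), one_smul, sub_self]

/-- `⟨□ũ, φ⟩ = ⟨□ũ, 𝓔q⟩` for a test function `φ` with restriction `q` to `Q`: the difference
`φ - 𝓔q` lives at negative times. -/
theorem IsBox.apply_eq_apply_extend {u : L2 (Ω ×ˢ Ioo 0 T)} {ℓ : StrongDual ℝ (H10Q Ω T)}
    (hfin : IsFiniteMeasure (volume.restrict (Ω ×ˢ Ioo (-T) T) : Measure (Pt n × ℝ)))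
    (hℓ : IsBox Ω T u ℓ) {φ : Pt n × ℝ → ℝ} (hφ : IsTest (Ω ×ˢ Ioo (-T) T) φ) {w : H10Q Ω T}
    (hw : IsJetOf (H10Q.jet Ω T w) φ) {q : Y Ω T} (hq : IsJetOf (Y.jet Ω T q) φ) :
    ℓ w = ℓ (extend Ω T q) := by
  have h := sub_reflJet_mem_closure hfin hφ hw hq
  have hsub : closure {v : Jet (Ω ×ˢ Ioo (-T) T) |
      ∃ ψ, IsTest (Ω ×ˢ Ioo (-T) 0) ψ ∧ IsJetOf v ψ} ⊆ H10st (Ω ×ˢ Ioo (-T) T) :=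
    closure_mono fun v ⟨ψ, hψ, hv⟩ => ⟨ψ, hψ.mono (negTime_subset Ω T), hv⟩
  have hproj : H10Q.proj Ω T (H10Q.jet Ω T w - reflJet Ω T (Y.jet Ω T q)) =
      w - extend Ω T q := by
    rw [map_sub, proj_jet]
    rfl
  have hjet := jet_proj (hsub h)
  rw [← sub_eq_zero, ← map_sub, ← hproj]
  refine hℓ.eq_zero_of_mem_closure ?_
  rwa [hjet]

/-- The bound that makes `‖u‖_{L²} + ‖u‖_S` control the norm of `X`. -/
theorem norm_boxDual_le
    (hfin : IsFiniteMeasure (volume.restrict (Ω ×ˢ Ioo (-T) T) : Measure (Pt n × ℝ)))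
    (hT : 0 ≤ T) (u : X Ω T) : ‖H.boxDual Ω T (X.toH Ω T u)‖ ≤ ‖B Ω T u‖ := by
  set ℓ := H.boxDual Ω T (X.toH Ω T u)
  have hℓ : IsBox Ω T (X.toL2 Ω T u) ℓ := (X.toH Ω T u).2
  have hQ : Ω ×ˢ Ioo 0 T ⊆ Ω ×ˢ Ioo (-T) T :=
    prod_mono le_rfl (Ioo_subset_Ioo_left (by linarith))
  have key : ∀ v ∈ closure (testJet (Ω ×ˢ Ioo (-T) T) : Set (Jet (Ω ×ˢ Ioo (-T) T))),
      ‖ℓ (H10Q.proj Ω T v)‖ ≤ ‖B Ω T u‖ * ‖v‖ := by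
    have hcl : IsClosed {v : Jet (Ω ×ˢ Ioo (-T) T) |
        ‖ℓ (H10Q.proj Ω T v)‖ ≤ ‖B Ω T u‖ * ‖v‖} :=
      isClosed_le (ℓ.continuous.comp (H10Q.proj Ω T).continuous).norm
        (continuous_const.mul continuous_norm)
    refine closure_minimal ?_ hcl
    rintro v ⟨φ, hφ, hv⟩
    obtain ⟨q, hq⟩ := exists_isJetOf (Ω ×ˢ Ioo 0 T) hφ.1 hφ.2.1
    let q' : Y Ω T := ⟨q, mem_H11_of_isTest hφ hq⟩
    have hmem : v ∈ H10st (Ω ×ˢ Ioo (-T) T) := Submodule.le_topologicalClosure _ ⟨φ, hφ, hv⟩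
    change ‖ℓ (H10Q.proj Ω T v)‖ ≤ _
    rw [hℓ.apply_eq_apply_extend hfin hφ (w := H10Q.proj Ω T v) (q := q')
      (by rwa [jet_proj hmem]) hq]
    change ‖B Ω T u q'‖ ≤ _
    refine ((B Ω T u).le_opNorm q').trans ?_
    gcongr
    exact hq.norm_le hQ hv
  refine ℓ.opNorm_le_bound (norm_nonneg _) fun w => ?_
  have := key (H10Q.jet Ω T w) w.2
  rwa [proj_jet] at this

end Bound

/-! ### The energy product -/

section Energy
variable {n : ℕ} {Ω : Set (Pt n)} {T : ℝ}

/-- The gradient `(∂ₜp, ∇ₓp)` of the Riesz representative `p = A⁻¹Bu`, for which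
`⟨Su, v⟩ = ⟨∇p_u, ∇p_v⟩`. -/
noncomputable def dualGrad (Ω : Set (Pt n)) (T : ℝ) :
    X Ω T →L[ℝ] WithLp 2 (L2 (Ω ×ˢ Ioo 0 T) × L2vec (Ω ×ˢ Ioo 0 T)) :=
  (Y.grad Ω T).comp (((A Ω T).symm : StrongDual ℝ (Y Ω T) →L[ℝ] Y Ω T).comp (B Ω T))

theorem B_eq_inner (u : X Ω T) (q : Y Ω T) :
    B Ω T u q = inner ℝ (dualGrad Ω T u) (Y.grad Ω T q) := by
  conv_lhs => rw [← (A Ω T).apply_symm_apply (B Ω T u)]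
  exact laxEquiv_apply (aForm_coercive Ω T) _ q

theorem S_eq_inner (u v : X Ω T) :
    S Ω T u v = inner ℝ (dualGrad Ω T u) (dualGrad Ω T v) := by
  rw [S_apply, B_eq_inner, real_inner_comm]
  rfl

theorem normS_eq (u : X Ω T) : normS Ω T u = ‖dualGrad Ω T u‖ := by
  rw [normS, S_eq_inner, real_inner_self_eq_norm_sq, Real.sqrt_sq (norm_nonneg _)]

theorem norm_grad_le (q : Y Ω T) : ‖Y.grad Ω T q‖ ≤ ‖q‖ := by
  refine le_of_sq_le_sq ?_ (norm_nonneg _)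
  have := WithLp.prod_norm_sq_eq_of_L2 (Y.jet Ω T q)
  change ‖(Y.jet Ω T q).snd‖ ^ 2 ≤ ‖Y.jet Ω T q‖ ^ 2
  rw [this]
  exact le_add_of_nonneg_left (sq_nonneg _)

theorem norm_B_le (u : X Ω T) : ‖B Ω T u‖ ≤ ‖dualGrad Ω T u‖ := by
  refine (B Ω T u).opNorm_le_bound (norm_nonneg _) fun q => ?_
  rw [B_eq_inner]
  refine (norm_inner_le_norm _ _).trans ?_
  gcongr
  exact norm_grad_le q

theorem norm_sq_le_energy
    (hfin : IsFiniteMeasure (volume.restrict (Ω ×ˢ Ioo (-T) T) : Measure (Pt n × ℝ)))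
    (hT : 0 ≤ T) (u : X Ω T) : ‖u‖ ^ 2 ≤ ‖X.toL2 Ω T u‖ ^ 2 + ‖dualGrad Ω T u‖ ^ 2 := by
  have h : ‖u‖ ^ 2 = ‖X.toL2 Ω T u‖ ^ 2 + ‖H.boxDual Ω T (X.toH Ω T u)‖ ^ 2 :=
    WithLp.prod_norm_sq_eq_of_L2 (X.toH Ω T u).1
  rw [h]
  gcongr
  exact (norm_boxDual_le hfin hT u).trans (norm_B_le u)

end Energy
end WaveReg

theorem mainTheorem4 (n : ℕ) (hn : n = 1 ∨ n = 2 ∨ n = 3)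
    (Ω : Set (EuclideanSpace ℝ (Fin n))) (hΩ_open : IsOpen Ω) (hΩ_convex : Convex ℝ Ω)
    (hΩ_bounded : Bornology.IsBounded Ω) (hΩ_nonempty : Ω.Nonempty)
    (T : ℝ) (hT : 0 < T) (ρ : ℝ) (hρ : 0 < ρ)
    (ub : WaveReg.L2 (Ω ×ˢ Set.Ioo 0 T)) :
    (∃! u : WaveReg.X Ω T, WaveReg.IsSol Ω T ρ ub u) ∧
    ∀ u : WaveReg.X Ω T, WaveReg.IsSol Ω T ρ ub u →
      ‖WaveReg.X.toL2 Ω T u - ub‖ ≤ ‖ub‖ ∧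
      ∀ y : WaveReg.X Ω T, WaveReg.X.toL2 Ω T y = ub →
        ‖WaveReg.X.toL2 Ω T u - ub‖ ≤ √ρ * WaveReg.normS Ω T y ∧
        WaveReg.normS Ω T (u - y) ≤ WaveReg.normS Ω T y ∧
        ∀ f : WaveReg.L2 (Ω ×ˢ Set.Ioo 0 T),
          (∀ v : WaveReg.X Ω T, WaveReg.S Ω T y v = inner ℝ f (WaveReg.X.toL2 Ω T v)) →
            ‖WaveReg.X.toL2 Ω T u - ub‖ ≤ ρ * ‖f‖ ∧
            WaveReg.normS Ω T (u - y) ≤ √ρ * ‖f‖ := by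
  have hfin : MeasureTheory.IsFiniteMeasure (MeasureTheory.volume.restrict
      (Ω ×ˢ Set.Ioo (-T) T) : MeasureTheory.Measure (EuclideanSpace ℝ (Fin n) × ℝ)) :=
    MeasureTheory.isFiniteMeasure_restrict.2
      (hΩ_bounded.prod (Metric.isBounded_Ioo _ _)).measure_lt_top.ne
  simp only [WaveReg.IsSol, WaveReg.S_eq_inner, WaveReg.normS_eq]
  refine ⟨WaveReg.existsUnique_regularized _ _
    (WaveReg.norm_sq_le_energy hfin hT.le) hρ ub, fun u hu =>
    ⟨WaveReg.regularized_norm_sub_le hρ hu, ?_⟩⟩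
  rintro y rfl
  obtain ⟨h1, h2⟩ := WaveReg.regularized_energy_bounds hρ hu
  exact ⟨h1, h2, fun f hf => WaveReg.regularized_source_bounds hρ hu hf⟩
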